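/- **Theorem ($L^\infty$-estimates for local systems).** For every dimension $n$ and every $q<\infty$ there is a constant $c>0$, depending only on $q$ and $n$, with the following property. Let $\Omega\subset\mathbb{R}^n$ be open and bounded, let $B$ be a ball of radius $r>0$ such that the concentric ball $2B$ of radius $2r$ satisfies $2B\subset\Omega$, let $N\in\mathbb{N}$, and let $\varphi$ be an N-function with Simonenko indices $p$ and $q$, where $1\le p\le q<\infty$. Let $u\in W^{1,\varphi}(\Omega,\mathbb{R}^N)$ be a weak solution of the $\varphi$-Laplace system, that is, $$\int_\Omega \varphi'(|\nabla u|)\,\frac{\nabla u}{|\nabla u|}:\nabla\psi\,dx=0\qquad\text{for all }\psi\in W^{1,\varphi}_0(\Omega,\mathbb{R}^N).$$ Then $u\in L^\infty(B,\mathbb{R}^N)$, the function $\varphi(r^{-1}|u|)$ is integrable on $2B$, and $$\sup_B\varphi(r^{-1}|u|)\;\le\; c\,\frac{1}{|2B|}\int_{2B}\varphi(r^{-1}|u|)\,dx ,$$ where $\sup_B$ is the essential supremum. Here an N-function is a convex, left-continuous function $\varphi:[0,\infty)\to[0,\infty)$ with $\varphi(0)=0$, $\lim_{t\to0}\varphi(t)/t=0$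 and $\lim_{t\to\infty}\varphi(t)/t=\infty$; $\varphi'$ is its right derivative, and its Simonenko indices are $p=\inf_{t>0}\frac{\varphi'(t)t}{\varphi(t)}$ and $q=\sup_{t>0}\frac{\varphi'(t)t}{\varphi(t)}$. The Orlicz space $L^\varphi(\Omega)$ consists of the $v\in L^1_{\mathrm{loc}}(\Omega)$ with $\int_\Omega\varphi(|v|/\lambda)\,dx<\infty$ for some $\lambda>0$, and carries the Luxemburg norm $\|v\|_{L^\varphi}=\inf\{\lambda>0:\int_\Omega\varphi(|v|/\lambda)\,dx\le1\}$. $W^{1,\varphi}(\Omega,\mathbb{R}^N)$ is the space of $v\in L^\varphi$ with weak gradient $\nabla v\in L^\varphi$, with the norm $\|v\|_{L^\varphi}+\|\nabla v\|_{L^\varphi}$, and $W^{1,\varphi}_0(\Omega,\mathbb{R}^N)$ is the closure in it of $C_c^\infty(\Omega,\mathbb{R}^N)$. Matrices carry the Frobenius inner product $A:B=\sum_{i,j}A_{ij}B_{ij}$ and its norm, and $\varphi'(|Q|)Q/|Q|$ is read as $0$ at $Q=0$. -/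

import Mathlib

open MeasureTheory Set Filter Topology
open scoped ContDiff

noncomputable section

namespace OrliczSystem

/-- Euclidean space `ℝ^d`, with the Euclidean norm. -/
abbrev Vec (d : ℕ) : Type := EuclideanSpace ℝ (Fin d)

/-- Real `n × N` matrices with the Frobenius inner product `A : B = ∑ i j, A i j * B i j`
and the Frobenius norm `|A|`.  The gradient of `u : ℝ^n → ℝ^N` has entries
`(∇u) (i, j) = ∂_i u_j`. -/
abbrev Mat (n N : ℕ) : Type := EuclideanSpace ℝ (Fin n × Fin N)

/-- N-functions `φ : [0,∞) → [0,∞)`.  Only the values of `φ` on `[0,∞)` play a role. -/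
structure IsNFunction (φ : ℝ → ℝ) : Prop where
  nonneg : ∀ t, 0 ≤ t → 0 ≤ φ t
  convexOn : ConvexOn ℝ (Ici 0) φ
  leftContinuous : ∀ t, 0 ≤ t → ContinuousWithinAt φ (Icc 0 t) t
  map_zero : φ 0 = 0
  tendsto_zero : Tendsto (fun t => φ t / t) (𝓝[>] 0) (𝓝 0)
  tendsto_atTop : Tendsto (fun t => φ t / t) atTop atTop

/-- The right derivative `φ'` of `φ`. -/
def rightDeriv (φ : ℝ → ℝ) (t : ℝ) : ℝ := derivWithin φ (Ioi t) t

/-- `p` and `q` are the lower and the upper Simonenko index of `φ`: the infimum and the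
supremum of `φ'(t) t / φ(t)` over `t > 0`, both finite. -/
def HasSimonenkoIndices (φ : ℝ → ℝ) (p q : ℝ) : Prop :=
  IsGLB ((fun t => rightDeriv φ t * t / φ t) '' Ioi 0) p ∧
    IsLUB ((fun t => rightDeriv φ t * t / φ t) '' Ioi 0) q

/-- The modular `∫_Ω φ(|v(x)| / l) dx`, with values in `[0,∞]`. -/
def modular {n : ℕ} {F : Type*} [NormedAddCommGroup F]
    (φ : ℝ → ℝ) (Ω : Set (Vec n)) (v : Vec n → F) (l : ℝ) : ENNReal :=
  ∫⁻ x in Ω, ENNReal.ofReal (φ (‖v x‖ / l))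

/-- `v` belongs to the Orlicz space `L^φ(Ω)`. -/
def MemOrlicz {n : ℕ} {F : Type*} [NormedAddCommGroup F]
    (φ : ℝ → ℝ) (Ω : Set (Vec n)) (v : Vec n → F) : Prop :=
  LocallyIntegrableOn v Ω ∧ ∃ l : ℝ, 0 < l ∧ modular φ Ω v l < ⊤

/-- The Luxemburg norm on `L^φ(Ω)`, with values in `[0,∞]` (the infimum of the empty set
being `∞`). -/
def luxemburgNorm {n : ℕ} {F : Type*} [NormedAddCommGroup F]
    (φ : ℝ → ℝ) (Ω : Set (Vec n)) (v : Vec n → F) : ENNReal :=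
  ⨅ (l : ℝ) (_ : 0 < l ∧ modular φ Ω v l ≤ 1), ENNReal.ofReal l

/-- Smooth functions with compact support contained in `Ω`. -/
def IsTestFunction {n : ℕ} {F : Type*} [NormedAddCommGroup F] [NormedSpace ℝ F]
    (Ω : Set (Vec n)) (η : Vec n → F) : Prop :=
  ContDiff ℝ ∞ η ∧ HasCompactSupport η ∧ tsupport η ⊆ Ω

/-- `G` is the weak gradient of `u : Ω → ℝ^N` on the open set `Ω ⊆ ℝ^n`. -/
def HasWeakGradient {n N : ℕ} (Ω : Set (Vec n)) (u : Vec n → Vec N) (G : Vec n → Mat n N) :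
    Prop :=
  LocallyIntegrableOn u Ω ∧ LocallyIntegrableOn G Ω ∧
    ∀ η : Vec n → ℝ, IsTestFunction Ω η → ∀ (i : Fin n) (j : Fin N),
      ∫ x in Ω, u x j * fderiv ℝ η x (EuclideanSpace.single i 1) =
        -∫ x in Ω, G x (i, j) * η x

/-- The classical gradient of a differentiable function. -/
def classicalGradient {n N : ℕ} (ψ : Vec n → Vec N) (x : Vec n) : Mat n N :=
  WithLp.toLp 2 fun ij => fderiv ℝ ψ x (EuclideanSpace.single ij.1 1) ij.2

/-- `u` belongs to the Orlicz-Sobolev space `W^{1,φ}(Ω, ℝ^N)` and `G` is its weak gradient. -/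
def MemOrliczSobolevWith {n N : ℕ} (φ : ℝ → ℝ) (Ω : Set (Vec n))
    (u : Vec n → Vec N) (G : Vec n → Mat n N) : Prop :=
  MemOrlicz φ Ω u ∧ HasWeakGradient Ω u G ∧ MemOrlicz φ Ω G

/-- `ψ` belongs to `W^{1,φ}_0(Ω, ℝ^N)`, the closure in `W^{1,φ}(Ω, ℝ^N)` of the smooth
functions with compact support in `Ω`, and `G` is its weak gradient. -/
def MemOrliczSobolevZeroWith {n N : ℕ} (φ : ℝ → ℝ) (Ω : Set (Vec n))
    (ψ : Vec n → Vec N) (G : Vec n → Mat n N) : Prop :=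
  MemOrliczSobolevWith φ Ω ψ G ∧
    ∃ ψs : ℕ → Vec n → Vec N, (∀ k, IsTestFunction Ω (ψs k)) ∧
      Tendsto (fun k => luxemburgNorm φ Ω (fun x => ψs k x - ψ x) +
        luxemburgNorm φ Ω (fun x => classicalGradient (ψs k) x - G x)) atTop (𝓝 0)

/-- `A(Q) = φ'(|Q|) Q / |Q|`, equal to `0` at `Q = 0`. -/
def stress {n N : ℕ} (φ : ℝ → ℝ) (Q : Mat n N) : Mat n N :=
  (rightDeriv φ ‖Q‖ / ‖Q‖) • Q

/-- `u ∈ W^{1,φ}(Ω, ℝ^N)` is a weak solution of the `φ`-Laplace system: for every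
`ψ ∈ W^{1,φ}_0(Ω, ℝ^N)`, the integral `∫_Ω φ'(|∇u|) ∇u/|∇u| : ∇ψ dx` exists and vanishes. -/
def IsWeakSolution {n N : ℕ} (φ : ℝ → ℝ) (Ω : Set (Vec n)) (u : Vec n → Vec N) : Prop :=
  ∃ G : Vec n → Mat n N, MemOrliczSobolevWith φ Ω u G ∧
    ∀ (ψ : Vec n → Vec N) (H : Vec n → Mat n N), MemOrliczSobolevZeroWith φ Ω ψ H →
      IntegrableOn (fun x => inner ℝ (stress φ (G x)) (H x)) Ω ∧
        ∫ x in Ω, inner ℝ (stress φ (G x)) (H x) = 0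

end OrliczSystem

end

noncomputable section

namespace OrliczSystem

/-! The proof is a De Giorgi iteration carried out on the vector field `u` itself. Fix an integer `m
≥ 2` above `q`. Then `φ'(t) t ≤ m φ(t)`, so `φ(t) / t ^ m` is nonincreasing and `φ` is doubling with
constants that depend on `m` only. The quantity to be iterated is `a_k`, the integral of `φ(|u|/r)`
over the part of a ball of radius `R_k` where `|u| > γ_k`, with radii decreasing from `2r` to `r`
and levels increasing from `l/2` to `l`.

The system is tested with `η ^ m χ(u) u`, where `χ` is a smooth nondecreasing radial step between
two levels. Truncating along rays is what makes the argument work for systems: differentiating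
`χ(u)` produces a multiple of `∑ i, (∂_i u · u) ^ 2` with nonnegative factor, which can be dropped.
A Young inequality absorbs the term with `∇η`, and the Caccioppoli inequality
(`IsLocalSolution.caccioppoli`) bounds `φ(|∇u|)` on the inner superlevel set by `φ(|u|/r)` on the
outer one.

Next, the `W^{1,1}` Sobolev inequality is applied to `η F(u)`, where `F` is a `C¹` substitute for
`φ(|·|/r)` truncated between two levels. Its gradient is controlled by `φ(|u|/r) + φ(|∇u|)`. With
Chebyshev's bound for the measure of the superlevel set, this gives `a_{k+1} ≤ K B^k r⁻¹ a_k (a_k /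
φ(l/(2r))) ^ (1/n)` (`IsLocalSolution.deGiorgi_step`). Such a recursion forces `a_k → 0` if `a_0` is
small compared with `φ(l/(2r)) r^n`, and then `|u| ≤ l` a.e. on the smaller ball. Choosing `l` so
that smallness holds with equality, and doubling once, gives the estimate.

The nonlinear test functions are justified by mollification. Jensen's inequality dominates the
modulars of the mollified functions by mollified modulars, which converge in `L¹`, so a generalized
dominated convergence theorem passes to the limit both in the tested equation and in Sobolev's
inequality. -/

/-- N-functions that are positive on `(0, ∞)` and whose upper Simonenko index is at most `m`. -/
structure IsPowerNFunction (φ : ℝ → ℝ) (m : ℕ) : Prop extends IsNFunction φ where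
  two_le : 2 ≤ m
  pos : ∀ t, 0 < t → 0 < φ t
  index_le : ∀ t, 0 < t → rightDeriv φ t * t ≤ m * φ t

lemma IsNFunction.isPowerNFunction {φ : ℝ → ℝ} {p q : ℝ} {m : ℕ} (hφ : IsNFunction φ)
    (hi : HasSimonenkoIndices φ p q) (hp : 1 ≤ p) (hm : 2 ≤ m) (hq : q ≤ m) :
    IsPowerNFunction φ m := by
  have hpos : ∀ t, 0 < t → 0 < φ t := by
    intro t ht
    -- At a zero of `φ` the index quotient is `0` by the convention for division, which contradicts
    -- `1 ≤ p`.
    refine (hφ.nonneg t ht.le).lt_of_ne' fun h => ?_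
    have h1 : p ≤ rightDeriv φ t * t / φ t := hi.1.1 ⟨t, ht, rfl⟩
    rw [h, div_zero] at h1
    linarith
  refine { hφ with two_le := hm, pos := hpos, index_le := fun t ht => ?_ }
  have h1 : rightDeriv φ t * t / φ t ≤ q := hi.2.1 ⟨t, ht, rfl⟩
  rw [div_le_iff₀ (hpos t ht)] at h1
  exact h1.trans (mul_le_mul_of_nonneg_right hq (hpos t ht).le)

/-! ### Growth, Young-type inequalities and a `C¹` substitute for N-functions -/

section NFunction

variable {φ : ℝ → ℝ} {m : ℕ}

lemma IsNFunction.map_mul_le (h : IsNFunction φ) {a t : ℝ} (ha : 0 ≤ a) (ha1 : a ≤ 1)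
    (ht : 0 ≤ t) : φ (a * t) ≤ a * φ t := by
  have := h.convexOn.2 (self_mem_Ici (a := (0 : ℝ))) (mem_Ici.2 ht)
    (sub_nonneg.2 ha1) ha (sub_add_cancel 1 a)
  simpa [h.map_zero] using this

lemma IsNFunction.monotoneOn (h : IsNFunction φ) : MonotoneOn φ (Ici 0) := by
  intro s hs t ht hst
  rcases eq_or_lt_of_le (show (0 : ℝ) ≤ t from ht) with rfl | ht'
  · rw [le_antisymm hst hs]
  have h1 := h.map_mul_le (a := s / t) (div_nonneg hs ht) ((div_le_one ht').2 hst) ht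
  rw [div_mul_cancel₀ _ ht'.ne'] at h1
  refine h1.trans (mul_le_of_le_one_left (h.nonneg t ht) ((div_le_one ht').2 hst))

lemma IsNFunction.mono (h : IsNFunction φ) {s t : ℝ} (hs : 0 ≤ s) (hst : s ≤ t) : φ s ≤ φ t :=
  h.monotoneOn hs (hs.trans hst) hst

lemma IsNFunction.continuousOn (h : IsNFunction φ) : ContinuousOn φ (Ici 0) := by
  intro t ht
  rcases eq_or_lt_of_le (show (0 : ℝ) ≤ t from ht) with rfl | ht'
  · rw [← continuousWithinAt_Ioi_iff_Ici]
    unfold ContinuousWithinAt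
    have h1 : Tendsto (fun t : ℝ => t) (𝓝[>] 0) (𝓝 0) := tendsto_id.mono_left nhdsWithin_le_nhds
    have h2 := h.tendsto_zero.mul h1
    rw [h.map_zero]
    simp only [mul_zero] at h2
    refine h2.congr' ?_
    filter_upwards [self_mem_nhdsWithin] with x hx
    exact div_mul_cancel₀ _ (ne_of_gt hx)
  · have := h.convexOn.continuousOn_interior
    rw [interior_Ici] at this
    exact ((this t ht').continuousAt (Ioi_mem_nhds ht')).continuousWithinAt

/-- Nothing is assumed about `φ` at negative arguments; composing with `max · 0` gives a function
continuous on the whole line, as the fundamental theorem of calculus needs. -/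
lemma IsNFunction.continuous_max (h : IsNFunction φ) : Continuous fun t => φ (max t 0) :=
  h.continuousOn.comp_continuous (by fun_prop) (fun t => by simp)

lemma IsNFunction.continuous_comp {X : Type*} [TopologicalSpace X] (h : IsNFunction φ)
    {f : X → ℝ} (hf : Continuous f) (h0 : ∀ x, 0 ≤ f x) : Continuous fun x => φ (f x) :=
  h.continuousOn.comp_continuous hf h0

lemma IsNFunction.hasDerivWithinAt (h : IsNFunction φ) {t : ℝ} (ht : 0 < t) :
    HasDerivWithinAt φ (rightDeriv φ t) (Ioi t) t :=
  h.convexOn.hasDerivWithinAt_rightDeriv_of_mem_interior (by simpa using ht)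

lemma IsNFunction.monotoneOn_rightDeriv (h : IsNFunction φ) :
    MonotoneOn (rightDeriv φ) (Ioi 0) := by
  have := h.convexOn.monotoneOn_rightDeriv
  rwa [interior_Ici] at this

/-- By convexity the slope `φ t / t` of the chord from the origin is at most the left derivative,
hence at most the right one. -/
lemma IsNFunction.le_rightDeriv_mul (h : IsNFunction φ) {t : ℝ} (ht : 0 < t) :
    φ t ≤ rightDeriv φ t * t := by
  have hi : t ∈ interior (Ici (0 : ℝ)) := by simpa using ht
  have h1 := h.convexOn.slope_le_leftDeriv_of_mem_interior (x := 0) (by simp) hi ht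
  have h2 := h1.trans (h.convexOn.leftDeriv_le_rightDeriv_of_mem_interior hi)
  rw [slope_def_field, h.map_zero, sub_zero, sub_zero, div_le_iff₀ ht] at h2
  exact h2

lemma IsNFunction.rightDeriv_nonneg (h : IsNFunction φ) {t : ℝ} (ht : 0 < t) :
    0 ≤ rightDeriv φ t := by
  have := (h.nonneg t ht.le).trans (h.le_rightDeriv_mul ht)
  exact nonneg_of_mul_nonneg_left this ht

lemma IsNFunction.rightDeriv_zero (h : IsNFunction φ) : rightDeriv φ 0 = 0 := by
  refine HasDerivWithinAt.derivWithin ?_ (uniqueDiffWithinAt_Ioi 0)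
  rw [hasDerivWithinAt_iff_tendsto_slope' self_notMem_Ioi]
  refine h.tendsto_zero.congr fun t => ?_
  simp [slope_def_field, h.map_zero]

/-- The quotient `φ x / x ^ m` has nonpositive right derivative by the index bound, and a continuous
function with this property is nonincreasing; no two-sided derivative is needed. -/
lemma IsPowerNFunction.map_mul_le_pow (h : IsPowerNFunction φ m) {l t : ℝ} (hl : 1 ≤ l)
    (ht : 0 ≤ t) : φ (l * t) ≤ l ^ m * φ t := by
  rcases eq_or_lt_of_le ht with rfl | ht'
  · simp [h.map_zero]
  have hpos : ∀ x ∈ Icc t (l * t), 0 < x := fun x hx => ht'.trans_le hx.1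
  have key := image_le_of_deriv_right_le_deriv_boundary (f := fun x => φ x / x ^ m)
    (f' := fun x => (rightDeriv φ x * x ^ m - φ x * (m * x ^ (m - 1))) / (x ^ m) ^ 2)
    (a := t) (b := l * t) (B := fun _ => φ t / t ^ m) (B' := fun _ => 0) ?_ ?_ le_rfl
    continuousOn_const (fun x _ => hasDerivWithinAt_const _ _ _) ?_
    (x := l * t) ⟨le_mul_of_one_le_left ht hl, le_rfl⟩
  · have hlt : 0 < l * t := by positivity
    rw [div_le_div_iff₀ (by positivity) (by positivity), mul_pow] at key
    have : 0 < t ^ m := by positivity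
    nlinarith
  · refine ContinuousOn.div (h.continuousOn.mono fun x hx => (hpos x hx).le) (by fun_prop)
      fun x hx => (pow_pos (hpos x hx) _).ne'
  · intro x hx
    have hx0 := hpos x ⟨hx.1, hx.2.le⟩
    have h1 := (h.hasDerivWithinAt hx0).Ici_of_Ioi
    exact h1.div (hasDerivAt_pow m x).hasDerivWithinAt (by positivity)
  · intro x hx
    have hx0 := hpos x ⟨hx.1, hx.2.le⟩
    refine div_nonpos_of_nonpos_of_nonneg ?_ (by positivity)
    have h1 := h.index_le x hx0
    have h2 : x ^ m = x ^ (m - 1) * x := by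
      rw [← pow_succ]; congr 1; have := h.two_le; omega
    rw [h2]
    have h3 : 0 < x ^ (m - 1) := by positivity
    nlinarith

lemma IsPowerNFunction.le_two_pow_mul_half (h : IsPowerNFunction φ m) {t : ℝ} (ht : 0 ≤ t) :
    φ t ≤ 2 ^ m * φ (t / 2) := by
  have := h.map_mul_le_pow (l := 2) (t := t / 2) (by norm_num) (by linarith)
  rwa [mul_div_cancel₀ _ two_ne_zero] at this

/-- Since `φ s / s` is nondecreasing, the product is at most the value of `φ` at the larger of the
two arguments. -/
lemma IsNFunction.div_mul_le (h : IsNFunction φ) {s t : ℝ} (hs : 0 < s) (ht : 0 ≤ t) :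
    φ s / s * t ≤ φ s + φ t := by
  have hφs := h.nonneg s hs.le
  have hφt := h.nonneg t ht
  rcases le_total t s with hts | hst
  · have : φ s / s * t ≤ φ s / s * s := by gcongr
    rw [div_mul_cancel₀ _ hs.ne'] at this
    linarith
  · have ht' := hs.trans_le hst
    have h1 := h.map_mul_le (a := s / t) (by positivity) ((div_le_one ht').2 hst) ht
    rw [div_mul_cancel₀ _ ht'.ne'] at h1
    have : φ s / s * t ≤ φ t := by
      rw [div_mul_eq_mul_div, div_le_iff₀ hs]
      rw [div_mul_eq_mul_div, le_div_iff₀ ht'] at h1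
      linarith
    linarith

lemma IsPowerNFunction.rightDeriv_mul_le (h : IsPowerNFunction φ m) {s t : ℝ} (hs : 0 ≤ s)
    (ht : 0 ≤ t) : rightDeriv φ s * t ≤ m * (φ s + φ t) := by
  have hφs := h.nonneg s hs
  have hφt := h.nonneg t ht
  rcases eq_or_lt_of_le hs with rfl | hs
  · rw [h.rightDeriv_zero, zero_mul]; positivity
  rcases le_total t s with hts | hst
  · calc rightDeriv φ s * t ≤ rightDeriv φ s * s :=
        mul_le_mul_of_nonneg_left hts (h.rightDeriv_nonneg hs)
      _ ≤ m * φ s := h.index_le s hs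
      _ ≤ m * (φ s + φ t) := by gcongr; linarith
  · have ht' := hs.trans_le hst
    calc rightDeriv φ s * t ≤ rightDeriv φ t * t :=
        mul_le_mul_of_nonneg_right (h.monotoneOn_rightDeriv hs ht' hst) ht
      _ ≤ m * φ t := h.index_le t ht'
      _ ≤ m * (φ s + φ t) := by gcongr; linarith

/-- A Young inequality without the conjugate function; `e` stands for the value of a cutoff and `d`
for the absorption parameter. If `a ≤ d e t`, the index bound gives the first term. Otherwise `t ≤ b
= a / (d e)`, so `φ'(t) a ≤ d e φ'(b) b ≤ d e m φ(b)`, and `φ(b) ≤ (d e)^(-m) φ(a)`; the factor `e ^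
(m - 1)` cancels the remaining negative powers of `e`. -/
lemma IsPowerNFunction.young (h : IsPowerNFunction φ m) {e d t a : ℝ} (he : 0 ≤ e) (he1 : e ≤ 1)
    (hd : 0 < d) (hd1 : d ≤ 1) (ht : 0 ≤ t) (ha : 0 ≤ a) :
    e ^ (m - 1) * (rightDeriv φ t * a) ≤
      d * m * (e ^ m * φ t) + m * (d⁻¹) ^ (m - 1) * φ a := by
  have hφt := h.nonneg t ht
  have hφa := h.nonneg a ha
  have hm := h.two_le
  have hpow : ∀ x : ℝ, x ^ m = x ^ (m - 1) * x := fun x => by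
    rw [← pow_succ]; congr 1; omega
  rcases eq_or_lt_of_le ht with rfl | ht
  · rw [h.rightDeriv_zero]; simp only [zero_mul, mul_zero]; positivity
  have hf := h.rightDeriv_nonneg ht
  rcases eq_or_lt_of_le he with rfl | he
  · rw [zero_pow (by omega), zero_mul]; positivity
  rcases le_or_gt a (d * e * t) with hat | hat
  · have h1 : e ^ (m - 1) * (rightDeriv φ t * a) ≤ e ^ (m - 1) * (rightDeriv φ t * (d * e * t)) := by
      gcongr
    have h2 := h.index_le t ht
    have h3 : d * e ^ m * (rightDeriv φ t * t) ≤ d * e ^ m * (m * φ t) := by gcongr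
    have h4 : 0 ≤ m * (d⁻¹) ^ (m - 1) * φ a := by positivity
    calc _ ≤ _ := h1
      _ = d * e ^ m * (rightDeriv φ t * t) := by rw [hpow]; ring
      _ ≤ _ := h3
      _ ≤ _ := by linarith
  · have hde : 0 < d * e := by positivity
    set b := (d * e)⁻¹ * a with hb
    have htb : t ≤ b := by
      rw [hb, inv_mul_eq_div, le_div_iff₀ hde]; linarith
    have hb0 : 0 < b := ht.trans_le htb
    have hab : a = d * e * b := by rw [hb, ← mul_assoc, mul_inv_cancel₀ hde.ne', one_mul]
    have h1 : rightDeriv φ t * a ≤ d * e * (m * φ b) := by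
      have := h.monotoneOn_rightDeriv ht hb0 htb
      calc rightDeriv φ t * a ≤ rightDeriv φ b * a := by gcongr
        _ = d * e * (rightDeriv φ b * b) := by rw [hab]; ring
        _ ≤ _ := mul_le_mul_of_nonneg_left (h.index_le b hb0) hde.le
    have h2 : φ b ≤ ((d * e)⁻¹) ^ m * φ a := by
      refine h.map_mul_le_pow ?_ ha
      exact (one_le_inv₀ hde).2 (mul_le_one₀ hd1 he.le he1)
    have h5 : 0 ≤ d * m * (e ^ m * φ t) := by positivity
    calc e ^ (m - 1) * (rightDeriv φ t * a)
        ≤ e ^ (m - 1) * (d * e * (m * (((d * e)⁻¹) ^ m * φ a))) := by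
          exact mul_le_mul_of_nonneg_left (h1.trans (by gcongr)) (by positivity)
      _ = m * (d⁻¹) ^ (m - 1) * φ a := by
          rw [mul_inv, mul_pow, hpow d⁻¹, hpow e⁻¹, inv_pow e]
          field_simp
      _ ≤ _ := by linarith

/-- The mean value of `φ` over `[0, t]`, a `C¹` function of `t > 0` comparable to `φ`. -/
def meanFn (φ : ℝ → ℝ) (t : ℝ) : ℝ := (∫ s in (0 : ℝ)..t, φ (max s 0)) / t

lemma IsNFunction.hasDerivAt_primitive (h : IsNFunction φ) (t : ℝ) :
    HasDerivAt (fun t => ∫ s in (0 : ℝ)..t, φ (max s 0)) (φ (max t 0)) t :=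
  intervalIntegral.integral_hasDerivAt_right (h.continuous_max.intervalIntegrable _ _)
    (h.continuous_max.stronglyMeasurableAtFilter _ _) h.continuous_max.continuousAt

lemma IsNFunction.contDiffAt_meanFn (h : IsNFunction φ) {t : ℝ} (ht : 0 < t) :
    ContDiffAt ℝ 1 (meanFn φ) t := by
  refine ContDiffAt.div ?_ contDiffAt_id ht.ne'
  refine ContDiff.contDiffAt (contDiff_one_iff_deriv.2
    ⟨fun x => (h.hasDerivAt_primitive x).differentiableAt, ?_⟩)
  rw [funext fun x => (h.hasDerivAt_primitive x).deriv]
  exact h.continuous_max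

lemma IsNFunction.meanFn_le (h : IsNFunction φ) {t : ℝ} (ht : 0 < t) : meanFn φ t ≤ φ t := by
  rw [meanFn, div_le_iff₀ ht]
  have := intervalIntegral.integral_mono_on (μ := volume) ht.le
    (h.continuous_max.intervalIntegrable 0 t)
    ((continuous_const (y := φ t)).intervalIntegrable 0 t)
    (fun _ hs => h.mono (le_max_right _ _) (max_le hs.2 ht.le))
  simpa [mul_comm] using this

lemma IsNFunction.meanFn_nonneg (h : IsNFunction φ) {t : ℝ} (ht : 0 < t) : 0 ≤ meanFn φ t :=
  div_nonneg (intervalIntegral.integral_nonneg ht.le fun _ _ => h.nonneg _ (le_max_right _ _)) ht.le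

/-- The half `[t/2, t]` of the interval alone contributes `φ (t / 2) / 2` to the mean, and doubling
compares this with `φ t`. -/
lemma IsPowerNFunction.le_meanFn (h : IsPowerNFunction φ m) {t : ℝ} (ht : 0 < t) :
    φ t ≤ 2 ^ (m + 1) * meanFn φ t := by
  have h1 := h.le_two_pow_mul_half ht.le
  have hI : ∀ a b, IntervalIntegrable (fun s => φ (max s 0)) volume a b :=
    fun a b => h.continuous_max.intervalIntegrable a b
  have h2 : t / 2 * φ (t / 2) ≤ ∫ s in (t / 2)..t, φ (max s 0) := by
    have := intervalIntegral.integral_mono_on (by linarith : t / 2 ≤ t)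
      ((continuous_const (y := φ (t / 2))).intervalIntegrable _ _) (hI (t / 2) t)
      (fun s hs => h.mono (by linarith) (hs.1.trans (le_max_left _ _)))
    rw [intervalIntegral.integral_const, smul_eq_mul] at this
    linarith
  have h3 : 0 ≤ ∫ s in (0 : ℝ)..(t / 2), φ (max s 0) :=
    intervalIntegral.integral_nonneg (by linarith) fun _ _ => h.nonneg _ (le_max_right _ _)
  have h4 := intervalIntegral.integral_add_adjacent_intervals (hI 0 (t / 2)) (hI (t / 2) t)
  have h5 : φ (t / 2) ≤ 2 * meanFn φ t := by
    rw [meanFn, ← mul_div_assoc, le_div_iff₀ ht]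
    linarith
  calc φ t ≤ 2 ^ m * φ (t / 2) := h1
    _ ≤ 2 ^ m * (2 * meanFn φ t) := by gcongr
    _ = _ := by ring

lemma IsNFunction.hasDerivAt_meanFn (h : IsNFunction φ) {t : ℝ} (ht : 0 < t) :
    HasDerivAt (meanFn φ) ((φ t - meanFn φ t) / t) t := by
  have := (h.hasDerivAt_primitive t).div (hasDerivAt_id t) ht.ne'
  refine this.congr_deriv ?_
  simp only [meanFn, max_eq_left ht.le, id]
  field_simp

lemma IsNFunction.abs_deriv_meanFn_le (h : IsNFunction φ) {t : ℝ} (ht : 0 < t) :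
    |deriv (meanFn φ) t| ≤ φ t / t := by
  have h1 := h.meanFn_le ht
  have h2 := h.meanFn_nonneg ht
  rw [(h.hasDerivAt_meanFn ht).deriv, abs_of_nonneg (div_nonneg (by linarith) ht.le)]
  gcongr
  linarith

end NFunction

/-! ### Generalized dominated convergence -/

section DominatedConvergence

variable {α : Type*} [MeasurableSpace α] {μ : Measure α}

/-- Dominated convergence with a convergent sequence of dominating functions. -/
lemma tendsto_integral_of_dominated_by_convergent {f h : ℕ → α → ℝ} {g H : α → ℝ}
    (hf : ∀ k, AEStronglyMeasurable (f k) μ) (hh : ∀ k, Integrable (h k) μ) (hH : Integrable H μ)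
    (hb : ∀ k, ∀ᵐ x ∂μ, |f k x| ≤ h k x)
    (hfg : ∀ᵐ x ∂μ, Tendsto (fun k => f k x) atTop (𝓝 (g x)))
    (hhH : ∀ᵐ x ∂μ, Tendsto (fun k => h k x) atTop (𝓝 (H x)))
    (hint : Tendsto (fun k => ∫ x, h k x ∂μ) atTop (𝓝 (∫ x, H x ∂μ))) :
    Integrable g μ ∧ Tendsto (fun k => ∫ x, f k x ∂μ) atTop (𝓝 (∫ x, g x ∂μ)) := by
  have hg : ∀ᵐ x ∂μ, |g x| ≤ H x := by
    filter_upwards [hfg, hhH, ae_all_iff.2 hb] with x h1 h2 h3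
    exact le_of_tendsto_of_tendsto' h1.abs h2 h3
  have hgm : AEStronglyMeasurable g μ := aestronglyMeasurable_of_tendsto_ae atTop hf hfg
  have hgi : Integrable g μ := hH.mono' hgm hg
  refine ⟨hgi, ?_⟩
  have hfi : ∀ k, Integrable (f k) μ := fun k => (hh k).mono' (hf k) (hb k)
  -- Since `h k ≥ |f k| ≥ 0`, the positive part of `H - h k` is dominated by the fixed function `H`.
  have hneg : Tendsto (fun k => ∫ x, max (H x - h k x) 0 ∂μ) atTop (𝓝 (∫ _, (0 : ℝ) ∂μ)) := by
    refine tendsto_integral_of_dominated_convergence H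
      (fun k => ((hH.sub (hh k)).pos_part).aestronglyMeasurable) hH (fun k => ?_) ?_
    · filter_upwards [hb k, hg] with x h1 h2
      have h3 := (abs_nonneg _).trans h1
      have h4 := (abs_nonneg _).trans h2
      rw [Real.norm_of_nonneg (le_max_right _ _)]
      exact max_le (by linarith) h4
    · filter_upwards [hhH] with x h1
      have := (h1.const_sub (H x)).max (tendsto_const_nhds (x := (0 : ℝ)))
      simpa using this
  -- Both signs together: `(h - H)⁺ = (h - H) + (H - h)⁺`, and the integral of `h k - H` tends to
  -- `0` by hypothesis.
  have hpos : Tendsto (fun k => ∫ x, max (h k x - H x) 0 ∂μ) atTop (𝓝 0) := by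
    have h1 : ∀ k, ∫ x, max (h k x - H x) 0 ∂μ =
        (∫ x, h k x ∂μ - ∫ x, H x ∂μ) + ∫ x, max (H x - h k x) 0 ∂μ := fun k => by
      rw [← integral_sub (hh k) hH, ← integral_add (f := fun x => h k x - H x)
        (g := fun x => max (H x - h k x) 0) ((hh k).sub hH) (hH.sub (hh k)).pos_part]
      refine integral_congr_ae (Eventually.of_forall fun x => ?_)
      simp only
      rcases le_total (h k x) (H x) with h' | h'
      · rw [max_eq_right (by linarith), max_eq_left (by linarith)]; ring
      · rw [max_eq_left (by linarith), max_eq_right (by linarith)]; ring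
    simp_rw [h1]
    simpa using (hint.sub_const (∫ x, H x ∂μ)).add hneg
  -- Ordinary dominated convergence applies to `f k` clamped to `[-H, H]`; the clamping error is at
  -- most `(h k - H)⁺`.
  have hclamp : Tendsto (fun k => ∫ x, max (-H x) (min (f k x) (H x)) ∂μ) atTop
      (𝓝 (∫ x, g x ∂μ)) := by
    refine tendsto_integral_of_dominated_convergence H
      (fun k => hH.aestronglyMeasurable.neg.sup ((hf k).inf hH.aestronglyMeasurable)) hH
      (fun k => ?_) ?_
    · filter_upwards [hg] with x h2
      have h4 := (abs_nonneg _).trans h2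
      rw [Real.norm_eq_abs, abs_le]
      exact ⟨le_max_left _ _, max_le (by linarith) (min_le_right _ _)⟩
    · filter_upwards [hfg, hg] with x h1 h2
      have h3 := (tendsto_const_nhds (x := -H x)).max (h1.min (tendsto_const_nhds (x := H x)))
      rw [min_eq_left (abs_le.1 h2).2, max_eq_right (abs_le.1 h2).1] at h3
      exact h3
  have hci : ∀ k, Integrable (fun x => max (-H x) (min (f k x) (H x))) μ := fun k =>
    hH.neg.sup ((hfi k).inf hH)
  have hdiff : Tendsto (fun k => ∫ x, f k x ∂μ - ∫ x, max (-H x) (min (f k x) (H x)) ∂μ) atTop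
      (𝓝 0) := by
    refine squeeze_zero_norm (fun k => ?_) hpos
    rw [← integral_sub (hfi k) (hci k)]
    refine norm_integral_le_of_norm_le (((hh k).sub hH).pos_part) ?_
    filter_upwards [hb k, hg] with x h1 h2
    have h4 := (abs_nonneg _).trans h2
    obtain ⟨h5, h6⟩ := abs_le.1 h1
    rw [Real.norm_eq_abs, abs_le]
    rcases le_total (f k x) (H x) with hfH | hfH
    · rw [min_eq_left hfH]
      rcases le_total (-H x) (f k x) with h' | h'
      · rw [max_eq_right h']; simp
      · rw [max_eq_left h']
        exact ⟨by linarith [le_max_left (h k x - H x) 0],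
          by linarith [le_max_right (h k x - H x) 0]⟩
    · rw [min_eq_right hfH, max_eq_right (neg_le_self h4)]
      exact ⟨by linarith [le_max_right (h k x - H x) 0],
        by linarith [le_max_left (h k x - H x) 0]⟩
  simpa using hdiff.add hclamp

end DominatedConvergence

/-! ### Smooth radial steps and cutoff functions -/

section Cutoff

lemma exists_smoothTransition_deriv_bound :
    ∃ S : ℝ, 1 ≤ S ∧ ∀ t, |deriv Real.smoothTransition t| ≤ S := by
  have hz : ∀ t, t ∉ Icc (0 : ℝ) 1 → deriv Real.smoothTransition t = 0 := by
    intro t ht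
    rcases lt_or_ge t 0 with h0 | h0
    · have : Real.smoothTransition =ᶠ[𝓝 t] fun _ => 0 := by
        filter_upwards [Iio_mem_nhds h0] with s hs
        exact Real.smoothTransition.zero_of_nonpos (le_of_lt hs)
      rw [this.deriv_eq, deriv_const]
    · have h1 : 1 < t := by
        by_contra h; exact ht ⟨h0, not_lt.1 h⟩
      have : Real.smoothTransition =ᶠ[𝓝 t] fun _ => 1 := by
        filter_upwards [Ioi_mem_nhds h1] with s hs
        exact Real.smoothTransition.one_of_one_le (le_of_lt hs)
      rw [this.deriv_eq, deriv_const]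
  have hc : HasCompactSupport (deriv Real.smoothTransition) :=
    HasCompactSupport.of_support_subset_isCompact isCompact_Icc fun t ht => by
      by_contra h; exact ht (hz t h)
  obtain ⟨S, hS⟩ := hc.exists_bound_of_continuous
    ((Real.smoothTransition.contDiff (n := 1)).continuous_deriv le_rfl)
  exact ⟨max S 1, le_max_right _ _, fun t => (hS t).trans (le_max_left _ _)⟩

variable {E : Type*} [NormedAddCommGroup E]

/-- A smooth radial function, equal to `0` for `‖y‖ ≤ a` and to `1` for `b ≤ ‖y‖`. -/
def radialStep (a b : ℝ) (y : E) : ℝ :=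
  Real.smoothTransition ((‖y‖ ^ 2 - a ^ 2) / (b ^ 2 - a ^ 2))

variable {a b : ℝ} {y w : E}

lemma radialStep_nonneg : 0 ≤ radialStep a b y := Real.smoothTransition.nonneg _

lemma radialStep_le_one : radialStep a b y ≤ 1 := Real.smoothTransition.le_one _

lemma radialStep_of_le (ha : 0 ≤ a) (hab : a < b) (h : ‖y‖ ≤ a) : radialStep a b y = 0 := by
  refine Real.smoothTransition.zero_of_nonpos (div_nonpos_of_nonpos_of_nonneg ?_ ?_)
  · have := pow_le_pow_left₀ (norm_nonneg y) h 2; linarith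
  · have := pow_le_pow_left₀ ha hab.le 2; linarith

lemma radialStep_of_ge (ha : 0 ≤ a) (hab : a < b) (h : b ≤ ‖y‖) : radialStep a b y = 1 := by
  have h1 := pow_lt_pow_left₀ hab ha two_ne_zero
  refine Real.smoothTransition.one_of_one_le ((one_le_div (by linarith)).2 ?_)
  have := pow_le_pow_left₀ (ha.trans hab.le) h 2
  linarith

variable [InnerProductSpace ℝ E]

lemma contDiff_radialStep {n : ℕ∞} : ContDiff ℝ n (radialStep a b : E → ℝ) :=
  Real.smoothTransition.contDiff.comp (((contDiff_norm_sq ℝ).sub contDiff_const).div_const _)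

lemma fderiv_radialStep : fderiv ℝ (radialStep a b) y w =
    deriv Real.smoothTransition ((‖y‖ ^ 2 - a ^ 2) / (b ^ 2 - a ^ 2)) *
      (2 * inner ℝ y w / (b ^ 2 - a ^ 2)) := by
  have h1 : HasFDerivAt (fun y : E => (‖y‖ ^ 2 - a ^ 2) / (b ^ 2 - a ^ 2))
      ((b ^ 2 - a ^ 2)⁻¹ • (2 • (innerSL ℝ y))) y := by
    simp_rw [div_eq_inv_mul]
    exact (((hasStrictFDerivAt_norm_sq y).hasFDerivAt).sub_const _).const_mul _
  have h2 := ((Real.smoothTransition.contDiff (n := 1)).differentiable one_ne_zero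
    ((‖y‖ ^ 2 - a ^ 2) / (b ^ 2 - a ^ 2))).hasDerivAt.comp_hasFDerivAt y h1
  have h3 : fderiv ℝ (radialStep a b) y = _ := h2.fderiv
  rw [h3]
  simp only [smul_apply, innerSL_apply_apply, smul_eq_mul, nsmul_eq_mul]
  push_cast
  ring

/-- The maximal value `1` is attained at `y`, which also covers the boundary sphere `‖y‖ = b`. -/
lemma fderiv_radialStep_of_ge (ha : 0 ≤ a) (hab : a < b) (h : b ≤ ‖y‖) :
    fderiv ℝ (radialStep a b) y = 0 := by
  have : IsLocalMax (radialStep a b) y := Eventually.of_forall fun z => by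
    rw [radialStep_of_ge ha hab h]; exact radialStep_le_one
  exact this.fderiv_eq_zero

/-- The gradient of a nondecreasing radial function is a nonnegative multiple of `y`. This sign
makes the derivative of the truncation harmless in the Caccioppoli inequality. -/
lemma fderiv_radialStep_mul_inner_nonneg (ha : 0 ≤ a) (hab : a < b) :
    0 ≤ fderiv ℝ (radialStep a b) y w * inner ℝ y w := by
  have h1 := pow_lt_pow_left₀ hab ha two_ne_zero
  have h2 : 0 ≤ deriv Real.smoothTransition ((‖y‖ ^ 2 - a ^ 2) / (b ^ 2 - a ^ 2)) :=
    Real.smoothTransition.monotone.deriv_nonneg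
  have h3 : 0 < b ^ 2 - a ^ 2 := by linarith
  rw [fderiv_radialStep, mul_assoc, div_mul_eq_mul_div, mul_assoc 2]
  have := mul_self_nonneg (inner ℝ y w)
  positivity

lemma norm_fderiv_radialStep_le {S : ℝ} (hS : ∀ t, |deriv Real.smoothTransition t| ≤ S)
    (ha : 0 ≤ a) (hab : a < b) : ‖fderiv ℝ (radialStep a b) y‖ ≤ 2 * S / (b - a) := by
  have hS0 : 0 ≤ S := (abs_nonneg _).trans (hS 0)
  have hba : 0 < b - a := by linarith
  have h3 : 0 < b ^ 2 - a ^ 2 := by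
    have h1 := pow_lt_pow_left₀ hab ha two_ne_zero; linarith
  rcases le_total b ‖y‖ with h | h
  · rw [fderiv_radialStep_of_ge ha hab h, norm_zero]; positivity
  refine ContinuousLinearMap.opNorm_le_bound _ (by positivity) fun w => ?_
  have h4 : |inner ℝ y w| ≤ b * ‖w‖ :=
    (abs_real_inner_le_norm y w).trans (by gcongr)
  rw [fderiv_radialStep, norm_mul, Real.norm_eq_abs, Real.norm_eq_abs, abs_div, abs_mul,
    abs_of_pos h3, abs_two]
  calc _ ≤ S * (2 * (b * ‖w‖) / (b ^ 2 - a ^ 2)) := by gcongr; exact hS _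
    _ ≤ S * (2 * ((b + a) * ‖w‖) / (b ^ 2 - a ^ 2)) := by gcongr; linarith
    _ = _ := by
      have : b ^ 2 - a ^ 2 = (b - a) * (b + a) := by ring
      have : b + a ≠ 0 := by linarith
      rw [‹b ^ 2 - a ^ 2 = _›]
      field_simp

/-- A cutoff function between two concentric balls. -/
lemma exists_cutoff {S : ℝ} (hS : ∀ t, |deriv Real.smoothTransition t| ≤ S)
    (x₀ : E) {ρ R : ℝ} (hρ : 0 ≤ ρ) (hR : ρ < R) :
    ∃ η : E → ℝ, ContDiff ℝ ∞ η ∧ (∀ x, 0 ≤ η x) ∧ (∀ x, η x ≤ 1) ∧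
      (∀ x ∈ Metric.closedBall x₀ ρ, η x = 1) ∧ tsupport η ⊆ Metric.closedBall x₀ R ∧
      ∀ x, ‖fderiv ℝ η x‖ ≤ 2 * S / (R - ρ) := by
  refine ⟨fun x => 1 - radialStep ρ R (x - x₀), ?_, fun x => ?_, fun x => ?_, fun x hx => ?_,
    ?_, fun x => ?_⟩
  · exact contDiff_const.sub (contDiff_radialStep.comp (contDiff_id.sub contDiff_const))
  · linarith [radialStep_le_one (a := ρ) (b := R) (y := x - x₀)]
  · linarith [radialStep_nonneg (a := ρ) (b := R) (y := x - x₀)]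
  · simp only
    rw [radialStep_of_le hρ hR (by simpa [dist_eq_norm] using hx), sub_zero]
  · refine closure_minimal (fun x hx => ?_) Metric.isClosed_closedBall
    by_contra h
    rw [Metric.mem_closedBall, dist_eq_norm, not_le] at h
    exact hx (by simp [radialStep_of_ge hρ hR h.le])
  · rw [fderiv_const_sub, norm_neg, fderiv_comp_sub]
    exact norm_fderiv_radialStep_le hS hρ hR

end Cutoff

/-! ### The Sobolev inequality for integrable gradients, on sets of finite measure -/

section Sobolev

/-- For `n ≥ 2`, Hölder's inequality on `E` is combined with the Gagliardo–Nirenberg inequality with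
exponent `n / (n - 1)`. For `n = 1` that exponent is infinite, and `|W| ≤ ∫ |W'|` is used directly
after identifying `Vec 1` with `ℝ`. -/
lemma exists_sobolev_const (n : ℕ) (hn : 1 ≤ n) : ∃ C : NNReal, 0 < C ∧
    ∀ W : Vec n → ℝ, ContDiff ℝ 1 W → HasCompactSupport W → ∀ E : Set (Vec n),
      ∫⁻ x in E, ‖W x‖ₑ ≤
        C * volume E ^ (1 / n : ℝ) * ∫⁻ x, ‖fderiv ℝ W x‖ₑ := by
  rcases eq_or_lt_of_le hn with rfl | hn
  · refine ⟨1, one_pos, fun W hW hcW E => ?_⟩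
    let b : OrthonormalBasis (Fin 1) ℝ ℝ := OrthonormalBasis.singleton (Fin 1) ℝ
    let e : ℝ ≃ₗᵢ[ℝ] Vec 1 := b.repr
    have hpt : ∀ x, ‖W x‖ₑ ≤ ∫⁻ x, ‖fderiv ℝ W x‖ₑ := by
      intro x
      have h1 := HasCompactSupport.enorm_le_lintegral_Ici_deriv (f := W ∘ e)
        (hW.comp e.contDiff) (hcW.comp_homeomorph e.toHomeomorph) (e.symm x)
      simp only [Function.comp_apply, e.apply_symm_apply] at h1
      refine h1.trans ((lintegral_mono' Measure.restrict_le_self le_rfl).trans ?_)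
      have h2 := b.measurePreserving_repr.lintegral_comp_emb
        b.repr.toHomeomorph.measurableEmbedding (fun x => ‖fderiv ℝ W x‖ₑ)
      rw [← h2]
      refine lintegral_mono fun t => ?_
      have h3 : HasDerivAt (fun t => e t) (e 1) t := by
        have := e.toContinuousLinearEquiv.toContinuousLinearMap.hasDerivAt (x := t)
        simpa using this
      have h4 : HasDerivAt (W ∘ e) (fderiv ℝ W (e t) (e 1)) t :=
        ((hW.differentiable one_ne_zero) (e t)).hasFDerivAt.comp_hasDerivAt t h3
      rw [show deriv (fun x => (W ∘ e) x) t = fderiv ℝ W (e t) (e 1) from h4.deriv]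
      refine (ContinuousLinearMap.le_opENorm _ _).trans ?_
      have h5 : ‖e 1‖ₑ = 1 := by
        rw [e.enorm_map]; simp
      rw [h5, mul_one]
    calc ∫⁻ x in E, ‖W x‖ₑ ≤ ∫⁻ _ in E, (∫⁻ x, ‖fderiv ℝ W x‖ₑ) := lintegral_mono hpt
      _ = _ := by simp [mul_comm]
  · let p : NNReal := NNReal.conjExponent n
    have hp : NNReal.HolderConjugate (n : NNReal) p := NNReal.HolderConjugate.conjExponent
      (by exact_mod_cast hn)
    refine ⟨eLpNormLESNormFDerivOneConst (volume : Measure (Vec n)) p + 1, by positivity,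
      fun W hW hcW E => ?_⟩
    have h1 := eLpNorm_le_eLpNorm_fderiv_one (volume : Measure (Vec n)) hW hcW (p := p)
      (by simpa using hp)
    have h2 := eLpNorm_le_eLpNorm_mul_rpow_measure_univ (p := 1) (q := p)
      (by exact_mod_cast hp.symm.coe.lt.le) (hW.continuous.aestronglyMeasurable
        (μ := volume.restrict E))
    rw [eLpNorm_one_eq_lintegral_enorm, Measure.restrict_apply_univ] at h2
    rw [eLpNorm_one_eq_lintegral_enorm] at h1
    have h3 : 1 / ENNReal.toReal 1 - 1 / ENNReal.toReal p = (1 / n : ℝ) := by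
      have := hp.coe.inv_add_inv_eq_one
      simp at this ⊢
      linarith
    rw [h3] at h2
    calc _ ≤ _ := h2
      _ ≤ eLpNorm W p volume * volume E ^ (1 / n : ℝ) := by
        gcongr; exact Measure.restrict_le_self
      _ ≤ (eLpNormLESNormFDerivOneConst (volume : Measure (Vec n)) p *
          ∫⁻ x, ‖fderiv ℝ W x‖ₑ) * volume E ^ (1 / n : ℝ) := by gcongr
      _ ≤ _ := by
        rw [mul_right_comm]
        gcongr
        simp

end Sobolev

/-- The supporting line at `a`, needed for Jensen's inequality; to the left of `a` the right
derivative may replace the left one, as it is larger and `t - a` is negative. -/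
lemma IsNFunction.add_rightDeriv_mul_sub_le {φ : ℝ → ℝ} (h : IsNFunction φ) {a t : ℝ} (ha : 0 < a)
    (ht : 0 ≤ t) : φ a + rightDeriv φ a * (t - a) ≤ φ t := by
  have hi : a ∈ interior (Ici (0 : ℝ)) := by simpa using ha
  rcases lt_trichotomy t a with hta | rfl | hat
  · have h1 := (h.convexOn.slope_le_leftDeriv_of_mem_interior (mem_Ici.2 ht) hi hta).trans
      (h.convexOn.leftDeriv_le_rightDeriv_of_mem_interior hi)
    rw [slope_def_field, div_le_iff₀ (by linarith)] at h1
    unfold rightDeriv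
    linarith
  · simp
  · have h1 := h.convexOn.rightDeriv_le_slope_of_mem_interior hi (mem_Ici.2 ht) hat
    rw [slope_def_field, le_div_iff₀ (by linarith)] at h1
    unfold rightDeriv
    linarith

/-! ### Mollification and Jensen's inequality -/

section Mollification

variable {n : ℕ} {F : Type*} [NormedAddCommGroup F] [NormedSpace ℝ F]

/-- The mollification of `g` with the kernel given by a normalized bump function. -/
def mollify (ρ : ContDiffBump (0 : Vec n)) (g : Vec n → F) : Vec n → F :=
  convolution (ρ.normed volume) g (ContinuousLinearMap.lsmul ℝ ℝ) volume

variable {ρ : ContDiffBump (0 : Vec n)} {g : Vec n → F}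

lemma mollify_apply (x : Vec n) : mollify ρ g x = ∫ y, ρ.normed volume (x - y) • g y := by
  rw [mollify, convolution_eq_swap]
  rfl

lemma integrable_mollify_integrand (hg : LocallyIntegrable g) (x : Vec n) :
    Integrable fun y => ρ.normed volume (x - y) • g y :=
  convolutionExistsAt_iff_integrable_swap.1
    (ρ.hasCompactSupport_normed.convolutionExists_left (ContinuousLinearMap.lsmul ℝ ℝ)
      ρ.continuous_normed hg x)

lemma contDiff_mollify [CompleteSpace F] (hg : LocallyIntegrable g) :
    ContDiff ℝ ∞ (mollify ρ g) :=
  ρ.hasCompactSupport_normed.contDiff_convolution_left _ (n := ⊤) ρ.contDiff_normed hg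

lemma integral_normed_sub (x : Vec n) : ∫ y, ρ.normed volume (x - y) = 1 := by
  rw [integral_sub_left_eq_self (fun y => ρ.normed volume y), ρ.integral_normed]

lemma integrable_mollify [CompleteSpace F] (hg : Integrable g) : Integrable (mollify ρ g) :=
  ρ.integrable_normed.integrable_convolution _ hg

lemma integral_mollify [CompleteSpace F] (hg : Integrable g) :
    ∫ x, mollify ρ g x = ∫ x, g x := by
  unfold mollify
  rw [integral_convolution _ ρ.integrable_normed hg, ρ.integral_normed]
  simp

/-- Jensen's inequality for mollifications. -/
lemma IsNFunction.map_norm_mollify_le {φ : ℝ → ℝ} (h : IsNFunction φ)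
    (hg : LocallyIntegrable g) (hφg : LocallyIntegrable fun x => φ ‖g x‖) (x : Vec n) :
    φ ‖mollify ρ g x‖ ≤ mollify ρ (fun x => φ ‖g x‖) x := by
  set a := ‖mollify ρ g x‖ with ha
  have hn : LocallyIntegrable fun x => ‖g x‖ := fun x =>
    let ⟨s, hs, h⟩ := hg x; ⟨s, hs, h.norm⟩
  have hi0 : Integrable fun y => ρ.normed volume (x - y) :=
    (ρ.integrable_normed (μ := volume)).comp_sub_left x
  have hi1 := integrable_mollify_integrand (ρ := ρ) hn x
  have heq : (fun y => ρ.normed volume (x - y) • (φ a + rightDeriv φ a * (‖g y‖ - a))) =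
      fun y => (φ a - rightDeriv φ a * a) * ρ.normed volume (x - y) +
        rightDeriv φ a * ρ.normed volume (x - y) • ‖g y‖ := by
    ext y; simp only [smul_eq_mul]; ring
  rcases eq_or_lt_of_le (norm_nonneg (mollify ρ g x)) with h0 | h0
  · rw [ha, ← h0, h.map_zero, mollify_apply]
    exact integral_nonneg fun y => smul_nonneg (ρ.nonneg_normed _) (h.nonneg _ (norm_nonneg _))
  have h1 : a ≤ ∫ y, ρ.normed volume (x - y) • ‖g y‖ := by
    rw [ha, mollify_apply]
    refine (norm_integral_le_integral_norm _).trans (le_of_eq (integral_congr_ae ?_))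
    refine Eventually.of_forall fun y => ?_
    simp only [norm_smul, Real.norm_of_nonneg (ρ.nonneg_normed _), smul_eq_mul]
  -- The supporting line of `φ` at `a` is integrated against the kernel, a probability density; `a`
  -- itself is at most the mean of `‖g‖`.
  have h2 : ∫ y, ρ.normed volume (x - y) • (φ a + rightDeriv φ a * (‖g y‖ - a)) ≤
      ∫ y, ρ.normed volume (x - y) • φ ‖g y‖ := by
    refine integral_mono ?_ (integrable_mollify_integrand hφg x) fun y => ?_
    · rw [heq]
      exact (hi0.const_mul _).add (hi1.const_mul _)
    · exact mul_le_mul_of_nonneg_left (h.add_rightDeriv_mul_sub_le h0 (norm_nonneg _))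
        (ρ.nonneg_normed _)
  have h3 : ∫ y, ρ.normed volume (x - y) • (φ a + rightDeriv φ a * (‖g y‖ - a)) =
      φ a - rightDeriv φ a * a + rightDeriv φ a * ∫ y, ρ.normed volume (x - y) • ‖g y‖ := by
    rw [heq, integral_add (hi0.const_mul _) (hi1.const_mul _), integral_const_mul,
      integral_const_mul, integral_normed_sub, mul_one]
  rw [mollify_apply]
  refine le_trans ?_ h2
  rw [h3]
  have := mul_le_mul_of_nonneg_left h1 (h.rightDeriv_nonneg h0)
  linarith

end Mollification

/-! ### Smooth approximation of Sobolev functions with control of the modulars -/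

section WeakGradient

variable {n N : ℕ} {Ω K : Set (Vec n)} {u : Vec n → Vec N} {G : Vec n → Mat n N}

lemma norm_fderiv_apply_le (w : Vec n → Vec N) (x v : Vec n) :
    ‖fderiv ℝ w x v‖ ≤ ‖classicalGradient w x‖ * ‖v‖ := by
  have hv : v = ∑ i, v i • EuclideanSpace.single i (1 : ℝ) := by
    ext j; simp [Finset.sum_apply, Pi.single_apply]
  have h1 : ∀ j, fderiv ℝ w x v j = ∑ i, v i * classicalGradient w x (i, j) := by
    intro j
    conv_lhs => rw [hv]
    simp [classicalGradient]
  rw [EuclideanSpace.norm_eq, EuclideanSpace.norm_eq (classicalGradient w x),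
    EuclideanSpace.norm_eq v, ← Real.sqrt_mul (by positivity)]
  refine Real.sqrt_le_sqrt ?_
  rw [Fintype.sum_prod_type_right, Finset.sum_mul]
  refine Finset.sum_le_sum fun j _ => ?_
  rw [h1]
  simp only [Real.norm_eq_abs, sq_abs]
  refine (Finset.sum_mul_sq_le_sq_mul_sq _ _ _).trans (le_of_eq (mul_comm _ _))

/-- For fixed `x` the kernel `y ↦ ρ(x - y)` is supported in `K ⊆ Ω`, hence is an admissible test
function. The minus sign from differentiating in `y` instead of `x` cancels the one in the
definition of the weak gradient. -/
lemma classicalGradient_mollify (hw : HasWeakGradient Ω u G) (hK : IsCompact K) (hKΩ : K ⊆ Ω)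
    {ρ : ContDiffBump (0 : Vec n)} {x : Vec n} (hx : Metric.closedBall x ρ.rOut ⊆ K) :
    classicalGradient (mollify ρ (K.indicator u)) x = mollify ρ (K.indicator G) x := by
  have hu : Integrable (K.indicator u) :=
    (hw.1.integrableOn_compact_subset hKΩ hK).integrable_indicator hK.measurableSet
  have hG : Integrable (K.indicator G) :=
    (hw.2.1.integrableOn_compact_subset hKΩ hK).integrable_indicator hK.measurableSet
  have hfd := ρ.hasCompactSupport_normed (μ := volume) |>.hasFDerivAt_convolution_left
    (ContinuousLinearMap.lsmul ℝ ℝ) ρ.contDiff_normed hu.locallyIntegrable x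
  set r : Vec n → ℝ := ρ.normed volume with hr
  set η : Vec n → ℝ := fun y => r (x - y) with hη
  have hηs : ContDiff ℝ ∞ η :=
    (ρ.contDiff_normed (n := ⊤)).comp (contDiff_const.sub contDiff_id)
  have hsupp : ∀ y, y ∉ K → η y = 0 := by
    intro y hy
    have h1 : x - y ∉ Function.support r := by
      rw [hr, ρ.support_normed_eq, mem_ball_zero_iff]
      intro h
      exact hy (hx (by rw [Metric.mem_closedBall, dist_comm, dist_eq_norm]; exact h.le))
    simpa [hη] using h1
  have htsupp : tsupport η ⊆ K := closure_minimal (fun y hy => by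
    by_contra h; exact hy (hsupp y h)) hK.isClosed
  have htest : IsTestFunction Ω η :=
    ⟨hηs, HasCompactSupport.of_support_subset_isCompact hK ((subset_tsupport _).trans htsupp),
      htsupp.trans hKΩ⟩
  have hdη : ∀ y v, fderiv ℝ η y v = - fderiv ℝ r (x - y) v := by
    intro y v
    have h1 : HasFDerivAt η ((fderiv ℝ r (x - y)).comp (-ContinuousLinearMap.id ℝ (Vec n))) y :=
      ((ρ.contDiff_normed (n := 1)).differentiable one_ne_zero (x - y)).hasFDerivAt.comp y
        ((hasFDerivAt_id y).const_sub x)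
    rw [h1.fderiv]
    simp
  ext ⟨i, j⟩
  have hL : classicalGradient (mollify ρ (K.indicator u)) x (i, j) =
      ∫ y, fderiv ℝ r (x - y) (EuclideanSpace.single i 1) * K.indicator u y j := by
    have h1 : fderiv ℝ (mollify ρ (K.indicator u)) x = _ := hfd.fderiv
    simp only [classicalGradient]
    have hint := convolutionExistsAt_iff_integrable_swap.1
      ((ρ.hasCompactSupport_normed (μ := volume)).fderiv ℝ |>.convolutionExists_left
      ((ContinuousLinearMap.lsmul ℝ ℝ).precompL (Vec n))
      ((ρ.contDiff_normed (n := 1)).continuous_fderiv one_ne_zero) hu.locallyIntegrable x)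
    rw [h1, convolution_eq_swap]
    let T : (Vec n →L[ℝ] Vec N) →L[ℝ] ℝ := (EuclideanSpace.proj j).comp
      (ContinuousLinearMap.apply ℝ _ (EuclideanSpace.single i (1 : ℝ)))
    refine (T.integral_comp_comm hint).symm.trans
      (integral_congr_ae (Eventually.of_forall fun y => ?_))
    simp [T]
    exact Or.inl rfl
  have hR : mollify ρ (K.indicator G) x (i, j) = ∫ y, η y * K.indicator G y (i, j) := by
    rw [mollify_apply]
    let T : Mat n N →L[ℝ] ℝ := EuclideanSpace.proj (i, j)
    exact (T.integral_comp_comm (integrable_mollify_integrand hG.locallyIntegrable x)).symm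
  have hweak := hw.2.2 η htest i j
  rw [hL, hR]
  have e1 : ∫ x in Ω, u x j * fderiv ℝ η x (EuclideanSpace.single i 1) =
      - ∫ y, fderiv ℝ r (x - y) (EuclideanSpace.single i 1) * K.indicator u y j := by
    rw [← integral_neg, setIntegral_eq_integral_of_forall_compl_eq_zero]
    · refine integral_congr_ae (Eventually.of_forall fun y => ?_)
      simp only [hdη]
      by_cases hy : y ∈ K
      · simp only [indicator_of_mem hy]; ring
      · have h0 : fderiv ℝ η y = 0 := image_eq_zero_of_notMem_tsupport
          (fun h => hy (htsupp (tsupport_fderiv_subset ℝ h)))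
        have h1 := hdη y (EuclideanSpace.single i 1)
        rw [h0] at h1
        simp [indicator_of_notMem hy, ← h1]
    · intro y hy
      have h0 : fderiv ℝ η y = 0 := image_eq_zero_of_notMem_tsupport
          (fun h => hy (hKΩ (htsupp (tsupport_fderiv_subset ℝ h))))
      simp [h0]
  have e2 : ∫ x in Ω, G x (i, j) * η x = ∫ y, η y * K.indicator G y (i, j) := by
    rw [setIntegral_eq_integral_of_forall_compl_eq_zero]
    · refine integral_congr_ae (Eventually.of_forall fun y => ?_)
      by_cases hy : y ∈ K
      · simp only [indicator_of_mem hy]; ring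
      · simp [hsupp y hy]
    · intro y hy
      simp [hsupp y (fun h => hy (hKΩ h))]
  linarith

/-- The sequence `w` consists of smooth functions that converge a.e. in the ball, together with
their gradients, to `u` and `G`; the modulars are dominated by a sequence that converges in
`L¹`. -/
structure IsSmoothApprox (φ : ℝ → ℝ) (x₀ : Vec n) (R : ℝ) (u : Vec n → Vec N)
    (G : Vec n → Mat n N) (w : ℕ → Vec n → Vec N) (h : ℕ → Vec n → ℝ) (H : Vec n → ℝ) : Prop where
  contDiff : ∀ k, ContDiff ℝ ∞ (w k)
  integrable : ∀ k, Integrable (h k)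
  integrable_lim : Integrable H
  tendsto_integral : Tendsto (fun k => ∫ x, h k x) atTop (𝓝 (∫ x, H x))
  tendsto_ae : ∀ᵐ x, Tendsto (fun k => h k x) atTop (𝓝 (H x))
  nonneg : ∀ k x, 0 ≤ h k x
  le : ∀ k, ∀ x ∈ Metric.ball x₀ R, φ ‖w k x‖ + φ ‖classicalGradient (w k) x‖ ≤ h k x
  tendsto_fun : ∀ᵐ x, x ∈ Metric.ball x₀ R → Tendsto (fun k => w k x) atTop (𝓝 (u x))
  tendsto_grad : ∀ᵐ x, x ∈ Metric.ball x₀ R →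
    Tendsto (fun k => classicalGradient (w k) x) atTop (𝓝 (G x))

/-- The approximants are mollifications of `u` cut off to the larger ball, and the dominating
functions are mollifications of the modulars. Mollification preserves integrals, so the integrals of
the dominating functions are constant in `k`. -/
lemma exists_isSmoothApprox {φ : ℝ → ℝ} (h : IsNFunction φ) {x₀ : Vec n} {R R' : ℝ}
    (hR : R < R') (hΩ : Metric.closedBall x₀ R' ⊆ Ω) (hw : HasWeakGradient Ω u G)
    (hu : IntegrableOn (fun x => φ ‖u x‖) (Metric.closedBall x₀ R'))
    (hG : IntegrableOn (fun x => φ ‖G x‖) (Metric.closedBall x₀ R')) :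
    ∃ w g H, IsSmoothApprox φ x₀ R u G w g H := by
  set K := Metric.closedBall x₀ R' with hKdef
  have hK : IsCompact K := isCompact_closedBall _ _
  have hui : Integrable (K.indicator u) :=
    (hw.1.integrableOn_compact_subset hΩ hK).integrable_indicator hK.measurableSet
  have hGi : Integrable (K.indicator G) :=
    (hw.2.1.integrableOn_compact_subset hΩ hK).integrable_indicator hK.measurableSet
  have hind : ∀ {F : Type} [NormedAddCommGroup F] (v : Vec n → F),
      (fun x => φ ‖K.indicator v x‖) = K.indicator fun x => φ ‖v x‖ := by
    intro F _ v
    ext x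
    by_cases hx : x ∈ K <;> simp [hx, h.map_zero]
  have hφu : Integrable fun x => φ ‖K.indicator u x‖ := by
    rw [hind]; exact hu.integrable_indicator hK.measurableSet
  have hφG : Integrable fun x => φ ‖K.indicator G x‖ := by
    rw [hind]; exact hG.integrable_indicator hK.measurableSet
  set ε := R' - R with hε
  have hεpos : 0 < ε := by linarith
  -- The outer radius tends to `0` and stays below `R' - R`; its bounded ratio to the inner radius
  -- is what a.e. convergence at Lebesgue points requires.
  let ρ : ℕ → ContDiffBump (0 : Vec n) := fun k =>
    ⟨ε / (2 * (k + 1)), ε / (k + 1), by positivity, by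
      refine div_lt_div_of_pos_left hεpos (by positivity) ?_
      have : (0 : ℝ) < k + 1 := by positivity
      linarith⟩
  have hρ : ∀ k, (ρ k).rOut ≤ ε := fun k =>
    div_le_self hεpos.le (by have : (0 : ℝ) ≤ k := by positivity
                             linarith)
  have hlim : Tendsto (fun k => (ρ k).rOut) atTop (𝓝 0) := by
    have := (tendsto_one_div_add_atTop_nhds_zero_nat (𝕜 := ℝ)).const_mul ε
    simpa [ρ, div_eq_mul_inv] using this
  have hratio : ∀ᶠ k in atTop, (ρ k).rOut ≤ 2 * (ρ k).rIn := Eventually.of_forall fun k => by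
    simp only [ρ]
    apply le_of_eq
    field_simp
  have hball : ∀ k, ∀ x ∈ Metric.ball x₀ R, Metric.closedBall x (ρ k).rOut ⊆ K := by
    intro k x hx
    refine Metric.closedBall_subset_closedBall' ?_
    have := hρ k
    rw [Metric.mem_ball] at hx
    linarith
  have hae : ∀ {F : Type} [NormedAddCommGroup F] [NormedSpace ℝ F] [CompleteSpace F]
      {v : Vec n → F}, Integrable v →
      ∀ᵐ x, Tendsto (fun k => mollify (ρ k) v x) atTop (𝓝 (v x)) := fun hv =>
    ContDiffBump.ae_convolution_tendsto_right_of_locallyIntegrable hlim hratio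
      hv.locallyIntegrable
  refine ⟨fun k => mollify (ρ k) (K.indicator u),
    fun k x => mollify (ρ k) (fun x => φ ‖K.indicator u x‖) x +
      mollify (ρ k) (fun x => φ ‖K.indicator G x‖) x,
    fun x => φ ‖K.indicator u x‖ + φ ‖K.indicator G x‖,
    fun k => contDiff_mollify hui.locallyIntegrable,
    fun k => (integrable_mollify hφu).add (integrable_mollify hφG), hφu.add hφG, ?_, ?_,
    fun k x => add_nonneg ?_ ?_, fun k x hx => add_le_add ?_ ?_, ?_, ?_⟩
  · refine tendsto_const_nhds.congr fun k => ?_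
    rw [integral_add hφu hφG, integral_add (integrable_mollify hφu) (integrable_mollify hφG),
      integral_mollify hφu, integral_mollify hφG]
  · filter_upwards [hae hφu, hae hφG] with x h1 h2 using h1.add h2
  · rw [mollify_apply]
    exact integral_nonneg fun y =>
      smul_nonneg ((ρ k).nonneg_normed _) (h.nonneg _ (norm_nonneg _))
  · rw [mollify_apply]
    exact integral_nonneg fun y =>
      smul_nonneg ((ρ k).nonneg_normed _) (h.nonneg _ (norm_nonneg _))
  · exact h.map_norm_mollify_le hui.locallyIntegrable hφu.locallyIntegrable x
  · rw [classicalGradient_mollify hw hK hΩ (hball k x hx)]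
    exact h.map_norm_mollify_le hGi.locallyIntegrable hφG.locallyIntegrable x
  · filter_upwards [hae hui] with x h1 hx
    rwa [indicator_of_mem (Metric.closedBall_subset_closedBall hR.le
      (Metric.ball_subset_closedBall hx))] at h1
  · filter_upwards [hae hGi] with x h1 hx
    rw [indicator_of_mem (Metric.closedBall_subset_closedBall hR.le
      (Metric.ball_subset_closedBall hx))] at h1
    refine h1.congr fun k => ?_
    rw [classicalGradient_mollify hw hK hΩ (hball k x hx)]

/-- The common limit passage: any integrand continuous in `(u, ∇u)` and growing at most like the
modulars, up to a fixed integrable function, is dominated along the sequence. -/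
lemma IsSmoothApprox.tendsto_setIntegral {φ : ℝ → ℝ} {x₀ : Vec n} {R : ℝ}
    {w : ℕ → Vec n → Vec N} {h : ℕ → Vec n → ℝ} {H : Vec n → ℝ}
    (ha : IsSmoothApprox φ x₀ R u G w h H) {Ψ : Vec n → Vec N → Mat n N → ℝ} {C : ℝ}
    (hC : 0 ≤ C) {g : Vec n → ℝ} (hg : IntegrableOn g (Metric.ball x₀ R))
    (hm : ∀ k, AEStronglyMeasurable (fun x => Ψ x (w k x) (classicalGradient (w k) x))
      (volume.restrict (Metric.ball x₀ R)))
    (hc : ∀ x ∈ Metric.ball x₀ R, Continuous fun p : Vec N × Mat n N => Ψ x p.1 p.2)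
    (hb : ∀ x ∈ Metric.ball x₀ R, ∀ y Q, |Ψ x y Q| ≤ C * (φ ‖y‖ + φ ‖Q‖) + g x) :
    IntegrableOn (fun x => Ψ x (u x) (G x)) (Metric.ball x₀ R) ∧
      Tendsto (fun k => ∫ x in Metric.ball x₀ R, Ψ x (w k x) (classicalGradient (w k) x)) atTop
        (𝓝 (∫ x in Metric.ball x₀ R, Ψ x (u x) (G x))) := by
  have hB : MeasurableSet (Metric.ball x₀ R) := measurableSet_ball
  have hgi : Integrable ((Metric.ball x₀ R).indicator g) := hg.integrable_indicator hB
  rw [← integrable_indicator_iff hB, ← integral_indicator hB]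
  simp_rw [← integral_indicator hB]
  refine tendsto_integral_of_dominated_by_convergent
    (h := fun k x => C * h k x + (Metric.ball x₀ R).indicator g x)
    (H := fun x => C * H x + (Metric.ball x₀ R).indicator g x)
    (fun k => (aestronglyMeasurable_indicator_iff hB).2 (hm k))
    (fun k => ((ha.integrable k).const_mul C).add hgi)
    ((ha.integrable_lim.const_mul C).add hgi) (fun k => Eventually.of_forall fun x => ?_) ?_ ?_ ?_
  · by_cases hx : x ∈ Metric.ball x₀ R
    · simp only [indicator_of_mem hx]
      refine (hb x hx _ _).trans ?_
      have := mul_le_mul_of_nonneg_left (ha.le k x hx) hC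
      linarith
    · simp only [indicator_of_notMem hx, abs_zero, add_zero]
      exact mul_nonneg hC (ha.nonneg k x)
  · filter_upwards [ha.tendsto_fun, ha.tendsto_grad] with x h1 h2
    by_cases hx : x ∈ Metric.ball x₀ R
    · simp only [indicator_of_mem hx]
      exact ((hc x hx).tendsto (u x, G x)).comp ((h1 hx).prodMk_nhds (h2 hx))
    · simp only [indicator_of_notMem hx]
      exact tendsto_const_nhds
  · filter_upwards [ha.tendsto_ae] with x h1
    exact (h1.const_mul C).add tendsto_const_nhds
  · have h1 : ∀ k, ∫ x, (C * h k x + (Metric.ball x₀ R).indicator g x) =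
        C * (∫ x, h k x) + ∫ x, (Metric.ball x₀ R).indicator g x := fun k => by
      rw [integral_add ((ha.integrable k).const_mul C) hgi, integral_const_mul]
    have h2 : ∫ x, (C * H x + (Metric.ball x₀ R).indicator g x) =
        C * (∫ x, H x) + ∫ x, (Metric.ball x₀ R).indicator g x := by
      rw [integral_add (ha.integrable_lim.const_mul C) hgi, integral_const_mul]
    simp_rw [h1, h2]
    exact (ha.tendsto_integral.const_mul C).add_const _

end WeakGradient

/-! ### Smooth test functions are admissible -/

section Admissible

variable {n N : ℕ} {φ : ℝ → ℝ} {Ω : Set (Vec n)}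

lemma continuous_classicalGradient {w : Vec n → Vec N} (hw : ContDiff ℝ 1 w) :
    Continuous (classicalGradient w) := by
  have h1 := hw.continuous_fderiv one_ne_zero
  unfold classicalGradient
  fun_prop

lemma classicalGradient_eq_zero {w : Vec n → Vec N} {x : Vec n} (hx : x ∉ tsupport w) :
    classicalGradient w x = 0 := by
  have h0 : fderiv ℝ w x = 0 := image_eq_zero_of_notMem_tsupport
    (fun h => hx (tsupport_fderiv_subset ℝ h))
  ext ij
  simp [classicalGradient, h0]

lemma IsNFunction.memOrlicz_of_hasCompactSupport (h : IsNFunction φ) {F : Type*}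
    [NormedAddCommGroup F] {v : Vec n → F} (hv : Continuous v) (hc : HasCompactSupport v) :
    MemOrlicz φ Ω v := by
  refine ⟨(hv.integrable_of_hasCompactSupport hc).integrableOn.locallyIntegrableOn, 1, one_pos, ?_⟩
  have h1 : Integrable fun x => φ (‖v x‖ / 1) := by
    simp_rw [div_one]
    refine (h.continuous_comp hv.norm fun x => norm_nonneg _).integrable_of_hasCompactSupport ?_
    exact hc.comp_left (g := fun y => φ ‖y‖) (by simp [h.map_zero])
  exact h1.integrableOn.lintegral_lt_top

lemma luxemburgNorm_zero (h0 : φ 0 = 0) {F : Type*} [NormedAddCommGroup F] :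
    luxemburgNorm φ Ω (fun _ : Vec n => (0 : F)) = 0 := by
  have h1 : ∀ l : ℝ, 0 < l → luxemburgNorm φ Ω (fun _ : Vec n => (0 : F)) ≤ ENNReal.ofReal l :=
    fun l hl => iInf₂_le l ⟨hl, by simp [modular, h0]⟩
  refine le_antisymm (ge_of_tendsto (x := 𝓝[>] (0 : ℝ)) (f := fun l => ENNReal.ofReal l) ?_ ?_)
    zero_le
  · have := (ENNReal.continuous_ofReal.tendsto 0).mono_left
      (nhdsWithin_le_nhds (s := Ioi (0 : ℝ)))
    simpa using this
  · filter_upwards [self_mem_nhdsWithin] with l hl using h1 l hl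

/-- Test functions belong to `W^{1,φ}_0`. -/
lemma IsNFunction.memOrliczSobolevZeroWith (h : IsNFunction φ) {ψ : Vec n → Vec N}
    (hψ : IsTestFunction Ω ψ) : MemOrliczSobolevZeroWith φ Ω ψ (classicalGradient ψ) := by
  obtain ⟨hs, hc, hΩ⟩ := hψ
  have hs1 : ContDiff ℝ 1 ψ := hs.of_le (by exact_mod_cast le_top)
  have hgc := continuous_classicalGradient hs1
  have hgs : HasCompactSupport (classicalGradient ψ) :=
    HasCompactSupport.of_support_subset_isCompact hc fun x hx => by
      by_contra h; exact hx (classicalGradient_eq_zero h)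
  have hm1 : MemOrlicz φ Ω ψ := h.memOrlicz_of_hasCompactSupport hs.continuous hc
  have hm2 : MemOrlicz φ Ω (classicalGradient ψ) := h.memOrlicz_of_hasCompactSupport hgc hgs
  refine ⟨⟨hm1, ⟨hm1.1, hm2.1, ?_⟩, hm2⟩, fun _ => ψ, fun _ => ⟨hs, hc, hΩ⟩, ?_⟩
  · intro η hη i j
    obtain ⟨hηs, hηc, hηΩ⟩ := hη
    have hη1 : ContDiff ℝ 1 η := hηs.of_le (by exact_mod_cast le_top)
    have hdη : Continuous fun x => fderiv ℝ η x (EuclideanSpace.single i 1) :=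
      (hη1.continuous_fderiv one_ne_zero).clm_apply continuous_const
    have hψj : ContDiff ℝ 1 fun x => ψ x j := by fun_prop
    have hdψ : ∀ x v, fderiv ℝ (fun x => ψ x j) x v = fderiv ℝ ψ x v j := by
      intro x v
      have h1 : HasFDerivAt (fun x => ψ x j) ((EuclideanSpace.proj j).comp (fderiv ℝ ψ x)) x :=
        (EuclideanSpace.proj (𝕜 := ℝ) j).hasFDerivAt.comp x
          ((hs1.differentiable one_ne_zero) x).hasFDerivAt
      rw [h1.fderiv]
      rfl
    have hdψc : Continuous fun x => fderiv ℝ (fun x => ψ x j) x (EuclideanSpace.single i 1) :=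
      (hψj.continuous_fderiv one_ne_zero).clm_apply continuous_const
    have hηz : ∀ x, x ∉ Ω → η x = 0 := fun x hx =>
      image_eq_zero_of_notMem_tsupport fun h => hx (hηΩ h)
    have hdηz : ∀ x, x ∉ tsupport η → fderiv ℝ η x (EuclideanSpace.single i 1) = 0 :=
      fun x hx => by
        rw [image_eq_zero_of_notMem_tsupport (f := fderiv ℝ η)
          (fun h => hx (tsupport_fderiv_subset ℝ h))]
        rfl
    have hcs : HasCompactSupport fun x => fderiv ℝ η x (EuclideanSpace.single i 1) :=
      HasCompactSupport.of_support_subset_isCompact hηc fun x hx => by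
        by_contra h; exact hx (hdηz x h)
    rw [setIntegral_eq_integral_of_forall_compl_eq_zero fun x hx => by
        rw [hdηz x (fun h => hx (hηΩ h)), mul_zero],
      setIntegral_eq_integral_of_forall_compl_eq_zero fun x hx => by rw [hηz x hx, mul_zero]]
    have key := integral_mul_fderiv_eq_neg_fderiv_mul_of_integrable (μ := volume)
      (f := fun x => ψ x j) (g := η) (v := EuclideanSpace.single i (1 : ℝ))
      ((hdψc.mul hη1.continuous).integrable_of_hasCompactSupport hηc.mul_left)
      ((hψj.continuous.mul hdη).integrable_of_hasCompactSupport hcs.mul_left)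
      ((hψj.continuous.mul hη1.continuous).integrable_of_hasCompactSupport hηc.mul_left)
      (fun x _ => hψj.differentiable one_ne_zero x) (fun x _ => hη1.differentiable one_ne_zero x)
    rw [key]
    simp_rw [hdψ]
    rfl
  · simp only [sub_self, luxemburgNorm_zero h.map_zero, add_zero]
    exact tendsto_const_nhds

end Admissible

/-! ### Testing the system with nonlinear functions of the solution -/

section LocalSolution

variable {n N : ℕ} {φ : ℝ → ℝ} {m : ℕ} {Ω : Set (Vec n)} {u : Vec n → Vec N} {G : Vec n → Mat n N}

/-- `u` has weak gradient `G`, finite modulars, and satisfies the `φ`-Laplace system tested with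
smooth functions. -/
structure IsLocalSolution (φ : ℝ → ℝ) (m : ℕ) (Ω : Set (Vec n)) (u : Vec n → Vec N)
    (G : Vec n → Mat n N) : Prop where
  growth : IsPowerNFunction φ m
  weakGradient : HasWeakGradient Ω u G
  integrable_fun : IntegrableOn (fun x => φ ‖u x‖) Ω
  integrable_grad : IntegrableOn (fun x => φ ‖G x‖) Ω
  weak_eq : ∀ ψ : Vec n → Vec N, IsTestFunction Ω ψ →
    ∫ x in Ω, inner ℝ (stress φ (G x)) (classicalGradient ψ x) = 0

lemma IsNFunction.aestronglyMeasurable_comp_norm (h : IsNFunction φ) {F : Type*}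
    [NormedAddCommGroup F] {v : Vec n → F} {μ : Measure (Vec n)} (hv : AEStronglyMeasurable v μ) :
    AEStronglyMeasurable (fun x => φ ‖v x‖) μ :=
  (h.continuous_comp continuous_norm fun x => norm_nonneg x).comp_aestronglyMeasurable hv

/-- By doubling, a finite modular at one scale `l` is finite at scale `1`. -/
lemma IsPowerNFunction.integrableOn_of_memOrlicz (h : IsPowerNFunction φ m) {F : Type*}
    [NormedAddCommGroup F] {v : Vec n → F} (hv : MemOrlicz φ Ω v) :
    IntegrableOn (fun x => φ ‖v x‖) Ω := by
  obtain ⟨hl, l, hl0, hmod⟩ := hv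
  have hm : AEStronglyMeasurable v (volume.restrict Ω) := hl.aestronglyMeasurable
  have h1 : IntegrableOn (fun x => φ (‖v x‖ / l)) Ω := by
    refine ⟨(h.continuous_comp (f := fun y : F => ‖y‖ / l) (by fun_prop)
      fun x => by positivity).comp_aestronglyMeasurable hm, ?_⟩
    rw [hasFiniteIntegral_iff_ofReal (Eventually.of_forall fun x => h.nonneg _ (by positivity))]
    exact hmod
  refine (h1.const_mul ((max l 1) ^ m)).mono' (h.aestronglyMeasurable_comp_norm hm)
    (Eventually.of_forall fun x => ?_)
  rw [Real.norm_of_nonneg (h.nonneg _ (norm_nonneg _))]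
  refine le_trans (h.mono (norm_nonneg _) ?_)
    (h.map_mul_le_pow (l := max l 1) (le_max_right _ _) (by positivity))
  calc ‖v x‖ = l * (‖v x‖ / l) := by field_simp
    _ ≤ _ := by gcongr; exact le_max_left _ _

lemma IsWeakSolution.exists_isLocalSolution (h : IsPowerNFunction φ m)
    (hu : IsWeakSolution φ Ω u) : ∃ G, IsLocalSolution φ m Ω u G := by
  obtain ⟨G, ⟨h1, h2, h3⟩, h4⟩ := hu
  exact ⟨G, h, h2, h.integrableOn_of_memOrlicz h1, h.integrableOn_of_memOrlicz h3,
    fun ψ hψ => (h4 ψ _ (h.memOrliczSobolevZeroWith hψ)).2⟩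

lemma measurable_stress (φ : ℝ → ℝ) :
    Measurable (stress φ : Mat n N → Mat n N) := by
  have h1 : Measurable (rightDeriv φ) := measurable_derivWithin_Ioi φ
  unfold stress
  fun_prop

lemma IsNFunction.norm_stress_le (h : IsNFunction φ) (Q : Mat n N) :
    ‖stress φ Q‖ ≤ rightDeriv φ ‖Q‖ := by
  rcases eq_or_ne Q 0 with rfl | hQ
  · simp [stress, h.rightDeriv_zero]
  · have hQ' : 0 < ‖Q‖ := norm_pos_iff.2 hQ
    rw [stress, norm_smul, Real.norm_of_nonneg (div_nonneg (h.rightDeriv_nonneg hQ') hQ'.le),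
      div_mul_cancel₀ _ hQ'.ne']

lemma IsSmoothApprox.tendsto_integral_of_support {x₀ : Vec n} {R ρ : ℝ}
    {w : ℕ → Vec n → Vec N} {h : ℕ → Vec n → ℝ} {H : Vec n → ℝ}
    (ha : IsSmoothApprox φ x₀ R u G w h H) (hρ : ρ < R) {Ψ : Vec n → Vec N → Mat n N → ℝ} {C : ℝ}
    (hC : 0 ≤ C) {g : Vec n → ℝ} (hg : IntegrableOn g (Metric.ball x₀ R))
    (hm : ∀ k, AEStronglyMeasurable (fun x => Ψ x (w k x) (classicalGradient (w k) x))
      (volume.restrict (Metric.ball x₀ R)))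
    (hc : ∀ x ∈ Metric.ball x₀ R, Continuous fun p : Vec N × Mat n N => Ψ x p.1 p.2)
    (hb : ∀ x ∈ Metric.ball x₀ R, ∀ y Q, |Ψ x y Q| ≤ C * (φ ‖y‖ + φ ‖Q‖) + g x)
    (hs : ∀ x, x ∉ Metric.closedBall x₀ ρ → ∀ y Q, Ψ x y Q = 0) :
    Integrable (fun x => Ψ x (u x) (G x)) ∧
      Tendsto (fun k => ∫ x, Ψ x (w k x) (classicalGradient (w k) x)) atTop
        (𝓝 (∫ x, Ψ x (u x) (G x))) := by
  have hs' : ∀ x, x ∉ Metric.ball x₀ R → ∀ y Q, Ψ x y Q = 0 := fun x hx =>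
    hs x fun h => hx (Metric.closedBall_subset_ball hρ h)
  obtain ⟨h1, h2⟩ := ha.tendsto_setIntegral hC hg hm hc hb
  refine ⟨(integrableOn_iff_integrable_of_support_subset fun x hx => ?_).1 h1, ?_⟩
  · by_contra h'; exact hx (hs' x h' _ _)
  · rw [setIntegral_eq_integral_of_forall_compl_eq_zero fun x hx => hs' x hx _ _] at h2
    refine h2.congr fun k => ?_
    rw [setIntegral_eq_integral_of_forall_compl_eq_zero fun x hx => hs' x hx _ _]

lemma IsLocalSolution.exists_isSmoothApprox (hl : IsLocalSolution φ m Ω u G) {x₀ : Vec n}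
    {R ρ : ℝ} (hR : Metric.ball x₀ R ⊆ Ω) (hρ : ρ < R) :
    ∃ w g H, IsSmoothApprox φ x₀ ((ρ + R) / 2) u G w g H := by
  have h1 : Metric.closedBall x₀ ((ρ + 3 * R) / 4) ⊆ Ω :=
    (Metric.closedBall_subset_ball (by linarith)).trans hR
  exact OrliczSystem.exists_isSmoothApprox hl.growth.toIsNFunction (by linarith) h1
    hl.weakGradient (hl.integrable_fun.mono_set h1) (hl.integrable_grad.mono_set h1)

/-- The `i`-th row of a matrix. -/
def row (Q : Mat n N) (i : Fin n) : Vec N := WithLp.toLp 2 fun j => Q (i, j)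

lemma sum_norm_row_sq (Q : Mat n N) : ∑ i, ‖row Q i‖ ^ 2 = ‖Q‖ ^ 2 := by
  simp_rw [EuclideanSpace.norm_sq_eq]
  rw [Fintype.sum_prod_type]
  rfl

lemma norm_row_le (Q : Mat n N) (i : Fin n) : ‖row Q i‖ ≤ ‖Q‖ := by
  refine (sq_le_sq₀ (norm_nonneg _) (norm_nonneg _)).1 ?_
  rw [← sum_norm_row_sq]
  exact Finset.single_le_sum (f := fun i => ‖row Q i‖ ^ 2) (fun _ _ => sq_nonneg _)
    (Finset.mem_univ i)

lemma continuous_row (i : Fin n) : Continuous fun Q : Mat n N => row Q i := by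
  unfold row
  fun_prop

/-- The gradient of `ζ P(u)` in terms of the values of `u` and `∇u`. -/
def productGradient (ζ : Vec n → ℝ) (P : Vec N → Vec N) (x : Vec n) (y : Vec N) (Q : Mat n N) :
    Mat n N :=
  WithLp.toLp 2 fun ij => fderiv ℝ ζ x (EuclideanSpace.single ij.1 1) * P y ij.2 +
    ζ x * fderiv ℝ P y (row Q ij.1) ij.2

lemma classicalGradient_smul_comp {ζ : Vec n → ℝ} {P : Vec N → Vec N} {w : Vec n → Vec N}
    (hζ : Differentiable ℝ ζ) (hP : Differentiable ℝ P) (hw : Differentiable ℝ w) (x : Vec n) :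
    classicalGradient (fun x => ζ x • P (w x)) x =
      productGradient ζ P x (w x) (classicalGradient w x) := by
  have h1 : HasFDerivAt (fun x => P (w x)) ((fderiv ℝ P (w x)).comp (fderiv ℝ w x)) x :=
    (hP (w x)).hasFDerivAt.comp x (hw x).hasFDerivAt
  have h2 := (hζ x).hasFDerivAt.smul h1
  ext ⟨i, j⟩
  have h3 : fderiv ℝ (fun x => ζ x • P (w x)) x = _ := h2.fderiv
  simp only [classicalGradient, productGradient]
  rw [h3]
  have h4 : row (classicalGradient w x) i = fderiv ℝ w x (EuclideanSpace.single i 1) := by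
    ext j; rfl
  simp only [classicalGradient] at h4
  simp [h4]
  ring

lemma continuous_productGradient (ζ : Vec n → ℝ) {P : Vec N → Vec N} (hP : ContDiff ℝ 1 P)
    (x : Vec n) : Continuous fun p : Vec N × Mat n N => productGradient ζ P x p.1 p.2 := by
  have h1 := hP.continuous_fderiv one_ne_zero
  have h2 := hP.continuous
  have h3 : ∀ i, Continuous fun Q : Mat n N => row Q i := continuous_row
  unfold productGradient
  fun_prop

lemma norm_le_sum_abs {ι : Type*} [Fintype ι] (v : EuclideanSpace ℝ ι) : ‖v‖ ≤ ∑ i, |v i| := by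
  classical
  have hv : v = ∑ i, v i • EuclideanSpace.single i (1 : ℝ) := by
    ext j; simp [Finset.sum_apply, Pi.single_apply]
  conv_lhs => rw [hv]
  refine (norm_sum_le _ _).trans (Finset.sum_le_sum fun i _ => ?_)
  simp [norm_smul]

/-- Growth bound for the limit passage: each of the `n * N` entries is estimated separately, and `P
0 = 0` turns the Lipschitz bound into `‖P y‖ ≤ L ‖y‖`. -/
lemma norm_productGradient_le {ζ : Vec n → ℝ} {P : Vec N → Vec N} {L M : ℝ} (hL : 0 ≤ L)
    (hM : 0 ≤ M) (hP0 : P 0 = 0)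
    (hP : Differentiable ℝ P) (hPL : ∀ y, ‖fderiv ℝ P y‖ ≤ L) {x : Vec n} (hζ : |ζ x| ≤ M)
    (hdζ : ‖fderiv ℝ ζ x‖ ≤ M) (y : Vec N) (Q : Mat n N) :
    ‖productGradient ζ P x y Q‖ ≤ (n * N) * (M * L) * (‖y‖ + ‖Q‖) := by
  have hPy : ‖P y‖ ≤ L * ‖y‖ := by
    have := Convex.norm_image_sub_le_of_norm_fderiv_le (𝕜 := ℝ) (f := P) (C := L) (x := 0) (y := y)
      (s := univ) (fun z _ => hP z) (fun z _ => hPL z) convex_univ (mem_univ _) (mem_univ _)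
    simpa [hP0] using this
  refine (norm_le_sum_abs _).trans ?_
  have h1 : ∀ ij ∈ Finset.univ (α := Fin n × Fin N),
      |productGradient ζ P x y Q ij| ≤ M * L * (‖y‖ + ‖Q‖) := by
    rintro ⟨i, j⟩ -
    simp only [productGradient]
    refine (abs_add_le _ _).trans ?_
    rw [abs_mul, abs_mul, mul_add]
    have e1 : |fderiv ℝ ζ x (EuclideanSpace.single i 1)| ≤ M := by
      refine ((fderiv ℝ ζ x).le_opNorm _).trans ?_
      simpa using hdζ
    have e2 : |P y j| ≤ L * ‖y‖ := (PiLp.norm_apply_le (P y) j).trans hPy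
    have e3 : |fderiv ℝ P y (row Q i) j| ≤ L * ‖Q‖ := by
      refine (PiLp.norm_apply_le _ j).trans (((fderiv ℝ P y).le_opNorm _).trans ?_)
      gcongr
      · exact hPL y
      · exact norm_row_le Q i
    calc _ ≤ M * (L * ‖y‖) + M * (L * ‖Q‖) := by gcongr
      _ = _ := by ring
  refine (Finset.sum_le_card_nsmul _ _ _ h1).trans (le_of_eq ?_)
  simp [mul_assoc]

/-- The system may be tested with `ζ P(u)`. -/
lemma IsLocalSolution.integral_productGradient_eq_zero (hl : IsLocalSolution φ m Ω u G)
    {x₀ : Vec n} {R ρ : ℝ} (hR : Metric.ball x₀ R ⊆ Ω) (hρ : ρ < R) {ζ : Vec n → ℝ}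
    (hζ : ContDiff ℝ ∞ ζ) (hζs : tsupport ζ ⊆ Metric.closedBall x₀ ρ) {P : Vec N → Vec N}
    (hP : ContDiff ℝ ∞ P) (hP0 : P 0 = 0) {L : ℝ} (hPL : ∀ y, ‖fderiv ℝ P y‖ ≤ L) :
    Integrable (fun x => inner ℝ (stress φ (G x)) (productGradient ζ P x (u x) (G x))) ∧
      ∫ x, inner ℝ (stress φ (G x)) (productGradient ζ P x (u x) (G x)) = 0 := by
  have h := hl.growth
  have hζ1 : ContDiff ℝ 1 ζ := hζ.of_le (by exact_mod_cast le_top)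
  have hP1 : ContDiff ℝ 1 P := hP.of_le (by exact_mod_cast le_top)
  have hL : 0 ≤ L := (norm_nonneg _).trans (hPL 0)
  have hζc : HasCompactSupport ζ :=
    HasCompactSupport.of_support_subset_isCompact (isCompact_closedBall x₀ ρ)
      ((subset_tsupport _).trans hζs)
  obtain ⟨M1, hM1⟩ := hζc.exists_bound_of_continuous hζ.continuous
  obtain ⟨M2, hM2⟩ := (hζc.fderiv ℝ).exists_bound_of_continuous
    (hζ1.continuous_fderiv one_ne_zero)
  set M := max M1 M2 with hMdef
  have hM : 0 ≤ M := (norm_nonneg _).trans ((hM1 x₀).trans (le_max_left _ _))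
  obtain ⟨w, g, H, ha⟩ := hl.exists_isSmoothApprox hR hρ
  have hsub : Metric.ball x₀ ((ρ + R) / 2) ⊆ Ω :=
    (Metric.ball_subset_ball (by linarith)).trans hR
  have hzero : ∀ x, x ∉ tsupport ζ → ∀ y Q, productGradient ζ P x y Q = 0 := by
    intro x hx y Q
    have h0 : fderiv ℝ ζ x = 0 := image_eq_zero_of_notMem_tsupport
      (fun h => hx (tsupport_fderiv_subset ℝ h))
    ext ij
    simp [productGradient, h0, image_eq_zero_of_notMem_tsupport hx]
  have hC : 0 ≤ (n * N : ℝ) * (M * L) := by positivity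
  have hstress : AEStronglyMeasurable (fun x => stress φ (G x))
      (volume.restrict (Metric.ball x₀ ((ρ + R) / 2))) :=
    ((measurable_stress φ).comp_aemeasurable
      (hl.weakGradient.2.1.aestronglyMeasurable.mono_measure
        (Measure.restrict_mono hsub le_rfl)).aemeasurable).aestronglyMeasurable
  have hw1 : ∀ k, ContDiff ℝ 1 (w k) := fun k => (ha.contDiff k).of_le (by exact_mod_cast le_top)
  have hgradeq : ∀ k x, classicalGradient (fun x => ζ x • P (w k x)) x =
      productGradient ζ P x (w k x) (classicalGradient (w k) x) := fun k x =>
    classicalGradient_smul_comp (hζ1.differentiable one_ne_zero) (hP1.differentiable one_ne_zero)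
      ((hw1 k).differentiable one_ne_zero) x
  -- The domination rests on `φ'(|G|) t ≤ m (φ(|G|) + φ(t))` with `t = ‖y‖` and `t = ‖Q‖`: the terms
  -- in `G` form the fixed function `g`, the others the modulars of the approximants.
  have key := ha.tendsto_integral_of_support (ρ := ρ) (by linarith)
    (Ψ := fun x y Q => inner ℝ (stress φ (G x)) (productGradient ζ P x y Q))
    (C := (n * N : ℝ) * (M * L) * m) (g := fun x => (n * N : ℝ) * (M * L) * m * (2 * φ ‖G x‖))
    (by positivity) (((hl.integrable_grad.mono_set hsub).const_mul 2).const_mul _) ?_ ?_ ?_ ?_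
  -- For every `k` the function `ζ P(w k)` is smooth with compact support in `Ω`, so the integrals
  -- along the sequence all vanish.
  · refine ⟨key.1, tendsto_nhds_unique key.2 (tendsto_const_nhds.congr fun k => ?_)⟩
    have hψ : ContDiff ℝ ∞ fun x => ζ x • P (w k x) := hζ.smul (hP.comp (ha.contDiff k))
    have hts : tsupport (fun x => ζ x • P (w k x)) ⊆ tsupport ζ := closure_mono fun x hx => by
      intro h0; exact hx (by simp [h0])
    have htest : IsTestFunction Ω fun x => ζ x • P (w k x) :=
      ⟨hψ, hζc.smul_right, (hts.trans hζs).trans ((Metric.closedBall_subset_ball hρ).trans hR)⟩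
    rw [← hl.weak_eq _ htest, setIntegral_eq_integral_of_forall_compl_eq_zero]
    · simp_rw [hgradeq]
    · intro x hx
      rw [hgradeq, hzero x fun h => hx (hR (Metric.closedBall_subset_ball hρ (hζs h))),
        inner_zero_right]
  · intro k
    refine hstress.inner (Continuous.aestronglyMeasurable ?_)
    rw [← funext (hgradeq k)]
    exact continuous_classicalGradient (hζ1.smul (hP1.comp (hw1 k)))
  · intro x _
    exact continuous_const.inner (continuous_productGradient ζ hP1 x)
  · intro x _ y Q
    have h1 := norm_productGradient_le hL hM hP0 (hP1.differentiable one_ne_zero) hPL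
      ((hM1 x).trans (le_max_left _ _)) ((hM2 x).trans (le_max_right _ _)) y Q
    have h2 := h.norm_stress_le (G x)
    have h3 := h.rightDeriv_mul_le (norm_nonneg (G x)) (norm_nonneg y)
    have h4 := h.rightDeriv_mul_le (norm_nonneg (G x)) (norm_nonneg Q)
    have h0 : 0 ≤ rightDeriv φ ‖G x‖ := (norm_nonneg _).trans h2
    calc |inner ℝ (stress φ (G x)) (productGradient ζ P x y Q)|
        ≤ ‖stress φ (G x)‖ * ‖productGradient ζ P x y Q‖ := abs_real_inner_le_norm _ _
      _ ≤ rightDeriv φ ‖G x‖ * ((n * N) * (M * L) * (‖y‖ + ‖Q‖)) := by gcongr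
      _ = (n * N) * (M * L) * (rightDeriv φ ‖G x‖ * ‖y‖ + rightDeriv φ ‖G x‖ * ‖Q‖) := by ring
      _ ≤ (n * N) * (M * L) * (m * (φ ‖G x‖ + φ ‖y‖) + m * (φ ‖G x‖ + φ ‖Q‖)) := by gcongr
      _ = _ := by ring
  · intro x hx y Q
    rw [hzero x (fun h => hx (hζs h)), inner_zero_right]

end LocalSolution

/-! ### Radial truncation of vectors -/

section RadialTruncation

variable {N : ℕ} {a b : ℝ}

/-- The radial truncation `y ↦ χ(y) y` with the step function `χ` between the radii `a` and `b`. -/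
def radialTruncation (a b : ℝ) (y : Vec N) : Vec N := radialStep a b y • y

lemma contDiff_radialTruncation : ContDiff ℝ ∞ (radialTruncation a b : Vec N → Vec N) :=
  (contDiff_radialStep (n := ⊤)).smul contDiff_id

lemma fderiv_radialTruncation (y w : Vec N) : fderiv ℝ (radialTruncation a b) y w =
    radialStep a b y • w + fderiv ℝ (radialStep a b) y w • y := by
  have h1 : DifferentiableAt ℝ (radialStep a b) y :=
    (contDiff_radialStep (n := 1)).differentiable one_ne_zero y
  have h2 : fderiv ℝ (radialTruncation a b) y = _ := (h1.hasFDerivAt.smul (hasFDerivAt_id y)).fderiv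
  rw [h2]
  simp

/-- The derivative of the step vanishes for `‖y‖ ≥ b`, so the factor `‖y‖` that accompanies it costs
at most `b`. -/
lemma norm_fderiv_radialTruncation_le {S : ℝ} (hS : ∀ t, |deriv Real.smoothTransition t| ≤ S)
    (ha : 0 ≤ a) (hab : a < b) (y : Vec N) :
    ‖fderiv ℝ (radialTruncation a b) y‖ ≤ 1 + 2 * S / (b - a) * b := by
  have hS0 : 0 ≤ S := (abs_nonneg _).trans (hS 0)
  have hba : 0 < b - a := by linarith
  have hb : 0 < b := by linarith
  refine ContinuousLinearMap.opNorm_le_bound _ (by positivity) fun w => ?_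
  rw [fderiv_radialTruncation]
  refine (norm_add_le _ _).trans ?_
  rw [norm_smul, norm_smul, add_mul]
  refine add_le_add ?_ ?_
  · rw [Real.norm_of_nonneg radialStep_nonneg]
    gcongr
    exact radialStep_le_one
  · rcases le_total b ‖y‖ with h | h
    · rw [fderiv_radialStep_of_ge ha hab h]
      simp only [zero_apply, norm_zero, zero_mul]
      positivity
    · calc ‖fderiv ℝ (radialStep a b) y w‖ * ‖y‖
          ≤ (‖fderiv ℝ (radialStep a b) y‖ * ‖w‖) * b := by
            gcongr; exact ContinuousLinearMap.le_opNorm _ _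
        _ ≤ (2 * S / (b - a) * ‖w‖) * b := by gcongr; exact norm_fderiv_radialStep_le hS ha hab
        _ = _ := by ring

end RadialTruncation

/-! ### The Caccioppoli inequality on superlevel sets -/

section Caccioppoli

variable {n N : ℕ} {φ : ℝ → ℝ} {m : ℕ} {Ω : Set (Vec n)} {u : Vec n → Vec N} {G : Vec n → Mat n N}

/-- The derivative of the step contributes, in each row, its value on the row times the inner
product of `y` with the row, which is nonnegative and is dropped. The term with `∇ζ` is `∇ζ` applied
to the vector `v` of inner products of the rows with `y`, and `‖v‖ ≤ ‖Q‖ ‖y‖` by Cauchy–Schwarz. -/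
lemma inner_productGradient_ge {ζ : Vec n → ℝ} {a b : ℝ} (ha : 0 ≤ a) (hab : a < b) (x : Vec n)
    (hζ : 0 ≤ ζ x) (y : Vec N) (Q : Mat n N) :
    radialStep a b y * (ζ x * ‖Q‖ ^ 2 - ‖fderiv ℝ ζ x‖ * (‖Q‖ * ‖y‖)) ≤
      inner ℝ Q (productGradient ζ (radialTruncation a b) x y Q) := by
  set v : Vec n := WithLp.toLp 2 fun i => inner ℝ (row Q i) y with hv
  have hvn : ‖v‖ ≤ ‖Q‖ * ‖y‖ := by
    refine (sq_le_sq₀ (norm_nonneg _) (by positivity)).1 ?_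
    rw [EuclideanSpace.norm_sq_eq, mul_pow, ← sum_norm_row_sq, Finset.sum_mul]
    refine Finset.sum_le_sum fun i _ => ?_
    rw [← mul_pow]
    exact pow_le_pow_left₀ (norm_nonneg _) (abs_real_inner_le_norm _ _) 2
  have hrow : ∀ i (w : Vec N), inner ℝ (row Q i) w = ∑ j, Q (i, j) * w j := by
    intro i w
    simp [PiLp.inner_apply, row, mul_comm]
  have hd : fderiv ℝ ζ x v = ∑ i, fderiv ℝ ζ x (EuclideanSpace.single i 1) * inner ℝ (row Q i) y := by
    have hv' : v = ∑ i, inner ℝ (row Q i) y • EuclideanSpace.single i (1 : ℝ) := by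
      ext j; simp [hv, Finset.sum_apply, Pi.single_apply]
    rw [hv']
    simp [mul_comm]
  have key : inner ℝ Q (productGradient ζ (radialTruncation a b) x y Q) =
      radialStep a b y * fderiv ℝ ζ x v +
        ζ x * ∑ i, inner ℝ (row Q i) (fderiv ℝ (radialTruncation a b) y (row Q i)) := by
    rw [hd, Finset.mul_sum, Finset.mul_sum, ← Finset.sum_add_distrib, PiLp.inner_apply,
      Fintype.sum_prod_type]
    refine Finset.sum_congr rfl fun i _ => ?_
    rw [hrow, hrow, Finset.mul_sum, Finset.mul_sum, Finset.mul_sum, ← Finset.sum_add_distrib]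
    refine Finset.sum_congr rfl fun j _ => ?_
    simp [productGradient, radialTruncation]
    ring
  have h1 : radialStep a b y * ‖Q‖ ^ 2 ≤
      ∑ i, inner ℝ (row Q i) (fderiv ℝ (radialTruncation a b) y (row Q i)) := by
    rw [← sum_norm_row_sq, Finset.mul_sum]
    refine Finset.sum_le_sum fun i _ => ?_
    rw [fderiv_radialTruncation, inner_add_right, inner_smul_right, inner_smul_right,
      real_inner_self_eq_norm_sq, real_inner_comm]
    have := fderiv_radialStep_mul_inner_nonneg (y := y) (w := row Q i) ha hab
    linarith
  have h2 : -(‖fderiv ℝ ζ x‖ * (‖Q‖ * ‖y‖)) ≤ fderiv ℝ ζ x v := by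
    have h3 := (abs_le.1 ((fderiv ℝ ζ x).le_opNorm v)).1
    have h4 : ‖fderiv ℝ ζ x‖ * ‖v‖ ≤ ‖fderiv ℝ ζ x‖ * (‖Q‖ * ‖y‖) := by gcongr
    linarith
  rw [key]
  have h5 := mul_le_mul_of_nonneg_left h2 (radialStep_nonneg (a := a) (b := b) (y := y))
  have h6 := mul_le_mul_of_nonneg_left h1 hζ
  nlinarith

/-- The constant in the Caccioppoli inequality. -/
def caccioppoliConst (m : ℕ) : ℝ := m * (m * (2 * m ^ 2) ^ (m - 1))

/-- The power `m` of the cutoff leaves `η ^ (m - 1)` after differentiation, exactly the weight that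
`IsPowerNFunction.young` can absorb. -/
lemma IsPowerNFunction.inner_stress_productGradient_ge (h : IsPowerNFunction φ m)
    {η : Vec n → ℝ} (hη : Differentiable ℝ η) {a b : ℝ} (ha : 0 ≤ a) (hab : a < b) (x : Vec n)
    (hη0 : 0 ≤ η x) (hη1 : η x ≤ 1) (y : Vec N) (Q : Mat n N) :
    radialStep a b y *
        (2⁻¹ * (η x ^ m * φ ‖Q‖) - caccioppoliConst m * φ (‖fderiv ℝ η x‖ * ‖y‖)) ≤
      inner ℝ (stress φ Q) (productGradient (fun x => η x ^ m) (radialTruncation a b) x y Q) := by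
  have hχ := radialStep_nonneg (a := a) (b := b) (y := y)
  have hm := h.two_le
  have hm0 : (2 : ℝ) ≤ m := by exact_mod_cast hm
  have hC : 0 ≤ caccioppoliConst m := by unfold caccioppoliConst; positivity
  rcases eq_or_ne Q 0 with rfl | hQ
  · have := h.nonneg (‖fderiv ℝ η x‖ * ‖y‖) (by positivity)
    simp only [stress, norm_zero, h.map_zero, smul_zero, inner_zero_left, mul_zero, zero_sub]
    nlinarith [mul_nonneg hχ (mul_nonneg hC this)]
  have hQ' : 0 < ‖Q‖ := norm_pos_iff.2 hQ
  have hf := h.rightDeriv_nonneg hQ'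
  have hd : ‖fderiv ℝ (fun x => η x ^ m) x‖ ≤ m * η x ^ (m - 1) * ‖fderiv ℝ η x‖ := by
    have h1 : fderiv ℝ (fun x => η x ^ m) x = _ := ((hη x).hasFDerivAt.pow m).fderiv
    rw [h1, norm_smul]
    simp only [nsmul_eq_mul]
    rw [Real.norm_of_nonneg (by positivity)]
  have h1 := inner_productGradient_ge ha hab x (ζ := fun x => η x ^ m) (by positivity) y Q
  -- With `d = 1 / (2 m²)`, the factor `m` from Young and the factor `m` from differentiating `η ^
  -- m` leave the coefficient `1/2`, so half of the gradient term survives.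
  have h2 := h.young (e := η x) (d := (2 * m ^ 2 : ℝ)⁻¹) (t := ‖Q‖)
    (a := ‖fderiv ℝ η x‖ * ‖y‖) hη0 hη1 (by positivity)
    (inv_le_one_of_one_le₀ (by nlinarith)) hQ'.le (by positivity)
  rw [inv_inv] at h2
  have h3 := h.le_rightDeriv_mul hQ'
  rw [stress, real_inner_smul_left]
  have h4 := mul_le_mul_of_nonneg_left h1 (div_nonneg hf hQ'.le)
  refine le_trans ?_ h4
  have e1 : rightDeriv φ ‖Q‖ / ‖Q‖ * (radialStep a b y *
      (η x ^ m * ‖Q‖ ^ 2 - ‖fderiv ℝ (fun x => η x ^ m) x‖ * (‖Q‖ * ‖y‖))) =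
      radialStep a b y * (η x ^ m * (rightDeriv φ ‖Q‖ * ‖Q‖) -
        ‖fderiv ℝ (fun x => η x ^ m) x‖ * (rightDeriv φ ‖Q‖ * ‖y‖)) := by
    field_simp
  rw [e1]
  refine mul_le_mul_of_nonneg_left ?_ hχ
  have h5 : ‖fderiv ℝ (fun x => η x ^ m) x‖ * (rightDeriv φ ‖Q‖ * ‖y‖) ≤
      m * (η x ^ (m - 1) * (rightDeriv φ ‖Q‖ * (‖fderiv ℝ η x‖ * ‖y‖))) := by
    calc _ ≤ m * η x ^ (m - 1) * ‖fderiv ℝ η x‖ * (rightDeriv φ ‖Q‖ * ‖y‖) := by gcongr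
      _ = _ := by ring
  have h6 := mul_le_mul_of_nonneg_left h2 (by positivity : (0 : ℝ) ≤ m)
  have h7 : η x ^ m * φ ‖Q‖ ≤ η x ^ m * (rightDeriv φ ‖Q‖ * ‖Q‖) := by gcongr
  have h8 : (m : ℝ) * ((2 * (m : ℝ) ^ 2)⁻¹ * m * (η x ^ m * φ ‖Q‖)) =
      2⁻¹ * (η x ^ m * φ ‖Q‖) := by field_simp
  rw [mul_add, h8] at h6
  unfold caccioppoliConst
  linarith

lemma IsPowerNFunction.comp_mul_norm_le (h : IsPowerNFunction φ m) {F : Type*}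
    [NormedAddCommGroup F] {c : ℝ} (hc : 0 ≤ c) (y : F) :
    φ (c * ‖y‖) ≤ (max c 1) ^ m * φ ‖y‖ :=
  (h.mono (by positivity) (by gcongr; exact le_max_left _ _)).trans
    (h.map_mul_le_pow (le_max_right c 1) (norm_nonneg y))

lemma IsLocalSolution.integrableOn_comp_mul (hl : IsLocalSolution φ m Ω u G) {c : ℝ}
    (hc : 0 ≤ c) : IntegrableOn (fun x => φ (c * ‖u x‖)) Ω := by
  have h := hl.growth
  refine (hl.integrable_fun.const_mul ((max c 1) ^ m)).mono' ?_ (Eventually.of_forall fun x => ?_)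
  · exact (h.continuous_comp (f := fun y : Vec N => c * ‖y‖) (by fun_prop)
      fun x => by positivity).comp_aestronglyMeasurable hl.weakGradient.1.aestronglyMeasurable
  · rw [Real.norm_of_nonneg (h.nonneg _ (by positivity))]
    exact h.comp_mul_norm_le hc (u x)

/-- The part of a ball where `‖u‖ > a`. -/
def superlevel (u : Vec n → Vec N) (x₀ : Vec n) (R a : ℝ) : Set (Vec n) :=
  Metric.ball x₀ R ∩ {x | a < ‖u x‖}

lemma measurableSet_superlevel (hu : Measurable u) (x₀ : Vec n) (R a : ℝ) :
    MeasurableSet (superlevel u x₀ R a) :=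
  measurableSet_ball.inter (measurableSet_lt measurable_const hu.norm)

/-- The cutoff passes from `1` to `0` between `ρ` and `(ρ + R) / 2`, whence `4 S / (R - ρ)`; the
rest of the gap leaves room for mollification. The step is `1` where `‖u‖ ≥ b` and `0` where `‖u‖ ≤
a`. -/
lemma IsLocalSolution.caccioppoli (hl : IsLocalSolution φ m Ω u G) (hu : Measurable u)
    {S : ℝ} (hS : ∀ t, |deriv Real.smoothTransition t| ≤ S)
    {x₀ : Vec n} {R ρ r L a b : ℝ} (hR : Metric.ball x₀ R ⊆ Ω) (hρ0 : 0 ≤ ρ) (hρ : ρ < R)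
    (hr : 0 < r) (hL1 : 1 ≤ L) (hL : 4 * S / (R - ρ) ≤ L / r) (ha : 0 ≤ a) (hab : a < b) :
    ∫ x in Metric.closedBall x₀ ρ ∩ {x | b ≤ ‖u x‖}, φ ‖G x‖ ≤
      2 * caccioppoliConst m * L ^ m * ∫ x in superlevel u x₀ R a, φ (r⁻¹ * ‖u x‖) := by
  have h := hl.growth
  obtain ⟨η, hη, hη0, hη1, hηone, hηs, hdη⟩ :=
    exists_cutoff hS x₀ hρ0 (show ρ < (ρ + R) / 2 by linarith)
  have hηd : Differentiable ℝ η := hη.differentiable (by simp)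
  have hm0 : m ≠ 0 := by have := h.two_le; omega
  have hζs : tsupport (fun x => η x ^ m) ⊆ Metric.closedBall x₀ ((ρ + R) / 2) :=
    (closure_mono fun x hx => by
      intro h0; exact hx (by simp [h0, hm0])).trans hηs
  obtain ⟨hint, hzero⟩ := hl.integral_productGradient_eq_zero hR
    (show (ρ + R) / 2 < R by linarith) (ζ := fun x => η x ^ m) (hη.pow m) hζs
    (P := radialTruncation a b) contDiff_radialTruncation (by simp [radialTruncation])
    (norm_fderiv_radialTruncation_le hS ha hab)
  set E := Metric.closedBall x₀ ρ ∩ {x | b ≤ ‖u x‖} with hE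
  have hEm : MeasurableSet E :=
    measurableSet_closedBall.inter (measurableSet_le measurable_const hu.norm)
  have hLm := measurableSet_superlevel hu x₀ R a
  have hEΩ : E ⊆ Ω := fun x hx => hR (Metric.closedBall_subset_ball hρ hx.1)
  have hLΩ : superlevel u x₀ R a ⊆ Ω := fun x hx => hR hx.1
  have hiE : Integrable (E.indicator fun x => φ ‖G x‖) :=
    (hl.integrable_grad.mono_set hEΩ).integrable_indicator hEm
  have hiL : Integrable ((superlevel u x₀ R a).indicator fun x => φ (r⁻¹ * ‖u x‖)) :=
    ((hl.integrableOn_comp_mul (by positivity)).mono_set hLΩ).integrable_indicator hLm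
  have hC : 0 ≤ caccioppoliConst m := by unfold caccioppoliConst; positivity
  -- A pointwise lower bound for the tested integrand, whose integral is zero; integrating it is the
  -- claim.
  have hpt : ∀ x, 2⁻¹ * E.indicator (fun x => φ ‖G x‖) x - caccioppoliConst m * L ^ m *
      (superlevel u x₀ R a).indicator (fun x => φ (r⁻¹ * ‖u x‖)) x ≤
      inner ℝ (stress φ (G x))
        (productGradient (fun x => η x ^ m) (radialTruncation a b) x (u x) (G x)) := by
    intro x
    by_cases hx : x ∈ Metric.ball x₀ R
    · refine le_trans ?_ (h.inner_stress_productGradient_ge hηd ha hab x (hη0 x) (hη1 x) (u x) (G x))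
      rw [mul_sub]
      have hφG := h.nonneg _ (norm_nonneg (G x))
      refine sub_le_sub ?_ ?_
      · by_cases hxE : x ∈ E
        · rw [indicator_of_mem hxE, radialStep_of_ge ha hab hxE.2, hηone x hxE.1]
          simp
        · rw [indicator_of_notMem hxE, mul_zero]
          have := hη0 x
          have := radialStep_nonneg (a := a) (b := b) (y := u x)
          positivity
      · by_cases hxL : x ∈ superlevel u x₀ R a
        · rw [indicator_of_mem hxL]
          have e1 : φ (‖fderiv ℝ η x‖ * ‖u x‖) ≤ L ^ m * φ (r⁻¹ * ‖u x‖) := by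
            refine le_trans (h.mono (by positivity) ?_) (h.map_mul_le_pow hL1 (by positivity))
            have e2 : ‖fderiv ℝ η x‖ ≤ L / r := by
              refine (hdη x).trans (le_trans (le_of_eq ?_) hL)
              have : R - ρ ≠ 0 := by linarith
              have : (ρ + R) / 2 - ρ = (R - ρ) / 2 := by ring
              rw [this]
              field_simp
              ring
            calc _ ≤ L / r * ‖u x‖ := by gcongr
              _ = _ := by ring
          have e3 := h.nonneg (‖fderiv ℝ η x‖ * ‖u x‖) (by positivity)
          calc _ ≤ 1 * (caccioppoliConst m * φ (‖fderiv ℝ η x‖ * ‖u x‖)) := by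
                gcongr; exact radialStep_le_one
            _ ≤ 1 * (caccioppoliConst m * (L ^ m * φ (r⁻¹ * ‖u x‖))) := by gcongr
            _ = _ := by ring
        · have hux : ‖u x‖ ≤ a := by
            by_contra h'; exact hxL ⟨hx, not_le.1 h'⟩
          rw [indicator_of_notMem hxL, radialStep_of_le ha hab hux]
          simp
    · have hxE : x ∉ E := fun h' => hx (Metric.closedBall_subset_ball hρ h'.1)
      have hxL : x ∉ superlevel u x₀ R a := fun h' => hx h'.1
      have hxη : x ∉ tsupport (fun x => η x ^ m) := fun h' =>
        hx (Metric.closedBall_subset_ball (by linarith) (hζs h'))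
      have h0 : productGradient (fun x => η x ^ m) (radialTruncation a b) x (u x) (G x) = 0 := by
        have h1 : fderiv ℝ (fun x => η x ^ m) x = 0 := image_eq_zero_of_notMem_tsupport
          (fun h => hxη (tsupport_fderiv_subset ℝ h))
        have h2 : η x ^ m = 0 := image_eq_zero_of_notMem_tsupport (f := fun x => η x ^ m) hxη
        ext ij
        simp [productGradient, h1, h2]
      rw [h0, indicator_of_notMem hxE, indicator_of_notMem hxL]
      simp
  have h1 := integral_mono ((hiE.const_mul 2⁻¹).sub (hiL.const_mul (caccioppoliConst m * L ^ m)))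
    hint hpt
  rw [hzero, integral_sub' (hiE.const_mul 2⁻¹) (hiL.const_mul (caccioppoliConst m * L ^ m)),
    integral_const_mul, integral_const_mul, integral_indicator hEm, integral_indicator hLm] at h1
  linarith

end Caccioppoli

/-! ### A truncated `C¹` version of the modular -/

section TruncatedMean

variable {N : ℕ} {φ : ℝ → ℝ} {m : ℕ}

/-- A `C¹` function comparable to `φ(‖y‖ / r)` for `‖y‖ ≥ b` and vanishing for `‖y‖ ≤ a`. -/
def truncatedMean (φ : ℝ → ℝ) (r a b : ℝ) (y : Vec N) : ℝ :=
  radialStep a b y * meanFn φ (r⁻¹ * ‖y‖)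

variable {r a b : ℝ}

lemma truncatedMean_of_le (ha : 0 ≤ a) (hab : a < b) {y : Vec N} (hy : ‖y‖ ≤ a) :
    truncatedMean φ r a b y = 0 := by
  rw [truncatedMean, radialStep_of_le ha hab hy, zero_mul]

lemma IsNFunction.truncatedMean_nonneg (h : IsNFunction φ) (hr : 0 < r) (ha : 0 ≤ a) (hab : a < b)
    (y : Vec N) : 0 ≤ truncatedMean φ r a b y := by
  rcases le_or_gt ‖y‖ a with hy | hy
  · rw [truncatedMean_of_le ha hab hy]
  · have : 0 < ‖y‖ := ha.trans_lt hy
    exact mul_nonneg radialStep_nonneg (h.meanFn_nonneg (by positivity))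

lemma IsNFunction.truncatedMean_le (h : IsNFunction φ) (hr : 0 < r) (ha : 0 ≤ a) (hab : a < b)
    (y : Vec N) : truncatedMean φ r a b y ≤ φ (r⁻¹ * ‖y‖) := by
  rcases le_or_gt ‖y‖ a with hy | hy
  · rw [truncatedMean_of_le ha hab hy]
    exact h.nonneg _ (by positivity)
  · have : 0 < ‖y‖ := ha.trans_lt hy
    exact (mul_le_of_le_one_left (h.meanFn_nonneg (by positivity)) radialStep_le_one).trans
      (h.meanFn_le (by positivity))

lemma IsPowerNFunction.le_truncatedMean (h : IsPowerNFunction φ m) (hr : 0 < r) (ha : 0 ≤ a)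
    (hab : a < b) {y : Vec N} (hy : b ≤ ‖y‖) :
    φ (r⁻¹ * ‖y‖) ≤ 2 ^ (m + 1) * truncatedMean φ r a b y := by
  have : 0 < ‖y‖ := ha.trans_lt (hab.trans_le hy)
  rw [truncatedMean, radialStep_of_ge ha hab hy, one_mul]
  exact h.le_meanFn (by positivity)

/-- The function vanishes for `‖y‖ ≤ a`, so the lack of smoothness of the norm at the origin plays
no role; this is where `0 < a` enters. -/
lemma IsNFunction.contDiff_truncatedMean (h : IsNFunction φ) (hr : 0 < r) (ha : 0 < a)
    (hab : a < b) : ContDiff ℝ 1 (truncatedMean φ r a b : Vec N → ℝ) := by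
  rw [contDiff_iff_contDiffAt]
  intro y
  rcases lt_or_ge ‖y‖ a with hy | hy
  · have : truncatedMean φ r a b =ᶠ[𝓝 y] fun _ => 0 := by
      filter_upwards [(isOpen_lt continuous_norm continuous_const).mem_nhds hy] with z hz
      exact truncatedMean_of_le ha.le hab (le_of_lt hz)
    exact contDiffAt_const.congr_of_eventuallyEq this
  · have hy0 : 0 < ‖y‖ := ha.trans_le hy
    refine (contDiff_radialStep (n := 1)).contDiffAt.mul ?_
    exact (h.contDiffAt_meanFn (t := r⁻¹ * ‖y‖) (by positivity)).comp y
      (contDiffAt_const.mul (contDiffAt_norm ℝ (norm_pos_iff.1 hy0)))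

lemma IsNFunction.fderiv_truncatedMean_of_le (h : IsNFunction φ) (hr : 0 < r) (ha : 0 ≤ a)
    (hab : a < b) {y : Vec N} (hy : ‖y‖ ≤ a) : fderiv ℝ (truncatedMean φ r a b) y = 0 := by
  have : IsLocalMin (truncatedMean φ r a b) y := Eventually.of_forall fun z => by
    rw [truncatedMean_of_le ha hab hy]; exact h.truncatedMean_nonneg hr ha hab z
  exact this.fderiv_eq_zero

/-- With `s = ‖y‖ / r`, both terms of the product rule are at most `(L / r) φ(s) / s`: the mean has
derivative at most `φ(s) / s`, and the step has derivative at most `L / b ≤ L / ‖y‖` where it is not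
constant. The factor `t`, later `|∇u|`, is then absorbed by `IsNFunction.div_mul_le`. -/
lemma IsNFunction.norm_fderiv_truncatedMean_mul_le (h : IsNFunction φ) {S L : ℝ}
    (hS : ∀ t, |deriv Real.smoothTransition t| ≤ S) (hr : 0 < r) (ha : 0 < a) (hab : a < b)
    (hL1 : 1 ≤ L) (hL : 2 * S / (b - a) ≤ L / b) (y : Vec N) {t : ℝ} (ht : 0 ≤ t) :
    ‖fderiv ℝ (truncatedMean φ r a b) y‖ * t ≤ 2 * (L / r) * (φ (r⁻¹ * ‖y‖) + φ t) := by
  rcases le_or_gt ‖y‖ a with hy | hy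
  · rw [h.fderiv_truncatedMean_of_le hr ha.le hab hy, norm_zero, zero_mul]
    have := h.nonneg (r⁻¹ * ‖y‖) (by positivity)
    have := h.nonneg t ht
    positivity
  have hy0 : 0 < ‖y‖ := ha.trans hy
  set s := r⁻¹ * ‖y‖ with hs
  have hs0 : 0 < s := by positivity
  have hb : 0 < b := ha.trans hab
  have hφs := h.nonneg s hs0.le
  have h1 : HasFDerivAt (fun y : Vec N => r⁻¹ * ‖y‖) (r⁻¹ • fderiv ℝ (fun y : Vec N => ‖y‖) y) y :=
    ((contDiffAt_norm (n := 1) ℝ (norm_pos_iff.1 hy0)).differentiableAt one_ne_zero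
      ).hasFDerivAt.const_mul _
  have hmean : HasDerivAt (meanFn φ) ((φ s - meanFn φ s) / s) (r⁻¹ * ‖y‖) :=
    h.hasDerivAt_meanFn hs0
  have h2 := hmean.comp_hasFDerivAt y h1
  have hcomp : (meanFn φ ∘ fun y : Vec N => r⁻¹ * ‖y‖) y = meanFn φ s := rfl
  have h3 : HasFDerivAt (radialStep a b) (fderiv ℝ (radialStep a b) y) y :=
    ((contDiff_radialStep (n := 1)).differentiable one_ne_zero y).hasFDerivAt
  have h4 : fderiv ℝ (truncatedMean φ r a b) y = _ := (h3.mul h2).fderiv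
  have h5 : ‖fderiv ℝ (fun y : Vec N => ‖y‖) y‖ ≤ 1 := by
    simpa using norm_fderiv_le_of_lipschitz ℝ (lipschitzWith_one_norm (E := Vec N)) (x₀ := y)
  have h6 : ‖fderiv ℝ (truncatedMean φ r a b) y‖ ≤ 2 * (L / r) * (φ s / s) := by
    rw [h4, hcomp]
    refine (norm_add_le _ _).trans ?_
    rw [norm_smul, norm_smul, norm_smul, norm_smul, Real.norm_of_nonneg radialStep_nonneg,
      Real.norm_of_nonneg (h.meanFn_nonneg hs0), Real.norm_of_nonneg (inv_nonneg.2 hr.le)]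
    have e1 : ‖(φ s - meanFn φ s) / s‖ ≤ φ s / s := by
      have := h.abs_deriv_meanFn_le hs0
      rwa [(h.hasDerivAt_meanFn hs0).deriv] at this
    have e2 : ‖fderiv ℝ (radialStep a b) y‖ ≤ L / ‖y‖ := by
      rcases le_total b ‖y‖ with hby | hby
      · rw [fderiv_radialStep_of_ge ha.le hab hby, norm_zero]; positivity
      · refine (norm_fderiv_radialStep_le hS ha.le hab).trans (hL.trans ?_)
        gcongr
    have e3 : radialStep a b y *
        (‖(φ s - meanFn φ s) / s‖ * (r⁻¹ * ‖fderiv ℝ (fun y : Vec N => ‖y‖) y‖))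
        ≤ 1 * (φ s / s * (r⁻¹ * 1)) := by
      gcongr
      exact radialStep_le_one
    have e4 : meanFn φ s * ‖fderiv ℝ (radialStep a b) y‖ ≤ φ s * (L / ‖y‖) := by
      gcongr
      exact h.meanFn_le hs0
    have e5 : φ s * (L / ‖y‖) = (L / r) * (φ s / s) := by rw [hs]; field_simp
    have e6 : 1 * (φ s / s * (r⁻¹ * 1)) ≤ (L / r) * (φ s / s) := by
      have : r⁻¹ ≤ L / r := by rw [inv_eq_one_div]; gcongr
      calc _ = r⁻¹ * (φ s / s) := by ring
        _ ≤ _ := by gcongr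
    linarith
  have h7 := h.div_mul_le hs0 ht
  calc _ ≤ 2 * (L / r) * (φ s / s) * t := by gcongr
    _ = 2 * (L / r) * (φ s / s * t) := by ring
    _ ≤ _ := by gcongr

end TruncatedMean

lemma exists_real_sobolev_const (n : ℕ) (hn : 1 ≤ n) : ∃ C : ℝ, 0 < C ∧
    ∀ W : Vec n → ℝ, ContDiff ℝ 1 W → HasCompactSupport W → ∀ E : Set (Vec n), volume E ≠ ⊤ →
      ∫ x in E, |W x| ≤ C * volume.real E ^ (1 / n : ℝ) * ∫ x, ‖fderiv ℝ W x‖ := by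
  obtain ⟨C, hC, h⟩ := exists_sobolev_const n hn
  refine ⟨C, hC, fun W hW hcW E hE => ?_⟩
  have h1 := h W hW hcW E
  have hi1 : Integrable W := hW.continuous.integrable_of_hasCompactSupport hcW
  have hi2 : Integrable (fderiv ℝ W) :=
    (hW.continuous_fderiv one_ne_zero).integrable_of_hasCompactSupport (hcW.fderiv ℝ)
  have hfin : (C : ENNReal) * volume E ^ (1 / n : ℝ) * ∫⁻ x, ‖fderiv ℝ W x‖ₑ ≠ ⊤ :=
    ENNReal.mul_ne_top (ENNReal.mul_ne_top ENNReal.coe_ne_top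
      (ENNReal.rpow_ne_top_of_nonneg (by positivity) hE)) hi2.2.ne
  have h2 := ENNReal.toReal_mono hfin h1
  rw [ENNReal.toReal_mul, ENNReal.toReal_mul, ← ENNReal.toReal_rpow, ENNReal.coe_toReal,
    ← integral_norm_eq_lintegral_enorm hi2.1,
    ← integral_norm_eq_lintegral_enorm hi1.1.restrict] at h2
  exact h2

/-! ### One step of the iteration -/

section OneStep

variable {n N : ℕ} {φ : ℝ → ℝ} {m : ℕ} {Ω : Set (Vec n)} {u : Vec n → Vec N} {G : Vec n → Mat n N}

lemma norm_fderiv_le_norm_classicalGradient (w : Vec n → Vec N) (x : Vec n) :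
    ‖fderiv ℝ w x‖ ≤ ‖classicalGradient w x‖ :=
  ContinuousLinearMap.opNorm_le_bound _ (norm_nonneg _) (norm_fderiv_apply_le w x)

lemma norm_fderiv_mul_comp_le {η : Vec n → ℝ} {F : Vec N → ℝ} {w : Vec n → Vec N}
    (hη : Differentiable ℝ η) (hF : Differentiable ℝ F) (hw : Differentiable ℝ w) {x : Vec n}
    (hη0 : 0 ≤ η x) (hF0 : 0 ≤ F (w x)) :
    ‖fderiv ℝ (fun x => η x * F (w x)) x‖ ≤ ‖fderiv ℝ η x‖ * F (w x) +
      η x * (‖fderiv ℝ F (w x)‖ * ‖classicalGradient w x‖) := by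
  have h1 : HasFDerivAt (fun x => F (w x)) ((fderiv ℝ F (w x)).comp (fderiv ℝ w x)) x :=
    (hF (w x)).hasFDerivAt.comp x (hw x).hasFDerivAt
  have h2 : fderiv ℝ (fun x => η x * F (w x)) x = _ := ((hη x).hasFDerivAt.mul h1).fderiv
  rw [h2, add_comm]
  refine (norm_add_le _ _).trans (add_le_add ?_ ?_)
  · rw [norm_smul, Real.norm_of_nonneg hF0, mul_comm]
  · rw [norm_smul, Real.norm_of_nonneg hη0]
    gcongr
    refine (ContinuousLinearMap.opNorm_comp_le _ _).trans ?_
    gcongr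
    exact norm_fderiv_le_norm_classicalGradient w x

/-- Sobolev's inequality for `η F(u)`, where `F = truncatedMean φ r a b`. -/
lemma IsLocalSolution.setIntegral_truncatedMean_le (hl : IsLocalSolution φ m Ω u G) {S L C : ℝ}
    (hS : ∀ t, |deriv Real.smoothTransition t| ≤ S) {x₀ : Vec n} {R ρ r a b : ℝ}
    (hC0 : 0 ≤ C)
    (hC : ∀ W : Vec n → ℝ, ContDiff ℝ 1 W → HasCompactSupport W → ∀ E : Set (Vec n),
      volume E ≠ ⊤ →
      ∫ x in E, |W x| ≤ C * volume.real E ^ (1 / n : ℝ) * ∫ x, ‖fderiv ℝ W x‖)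
    (hR : Metric.ball x₀ R ⊆ Ω) (hρ : ρ < R) (hr : 0 < r) (ha : 0 < a) (hab : a < b)
    (hL1 : 1 ≤ L) (hL : 2 * S / (b - a) ≤ L / b) {η : Vec n → ℝ} (hη : ContDiff ℝ ∞ η)
    (hη0 : ∀ x, 0 ≤ η x) (hη1 : ∀ x, η x ≤ 1) (hηs : tsupport η ⊆ Metric.closedBall x₀ ρ)
    (hdη : ∀ x, ‖fderiv ℝ η x‖ ≤ L / r) {E : Set (Vec n)} (hE : MeasurableSet E)
    (hEf : volume E ≠ ⊤) :
    Integrable (fun x => ‖fderiv ℝ η x‖ * truncatedMean φ r a b (u x) +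
        η x * (‖fderiv ℝ (truncatedMean φ r a b) (u x)‖ * ‖G x‖)) ∧
      ∫ x in E, η x * truncatedMean φ r a b (u x) ≤ C * volume.real E ^ (1 / n : ℝ) *
        ∫ x, (‖fderiv ℝ η x‖ * truncatedMean φ r a b (u x) +
          η x * (‖fderiv ℝ (truncatedMean φ r a b) (u x)‖ * ‖G x‖)) := by
  have h := hl.growth
  have hη' : ContDiff ℝ 1 η := hη.of_le (by exact_mod_cast le_top)
  obtain ⟨w, g, H, hw⟩ := hl.exists_isSmoothApprox hR hρ
  have hw1 : ∀ k, ContDiff ℝ 1 (w k) := fun k => (hw.contDiff k).of_le (by exact_mod_cast le_top)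
  set F : Vec N → ℝ := truncatedMean φ r a b with hF
  have hF1 : ContDiff ℝ 1 F := h.contDiff_truncatedMean hr ha hab
  have hF0 : ∀ y, 0 ≤ F y := h.truncatedMean_nonneg hr ha.le hab
  have hFφ : ∀ y, F y ≤ (max r⁻¹ 1) ^ m * φ ‖y‖ := fun y =>
    (h.truncatedMean_le hr ha.le hab y).trans (h.comp_mul_norm_le (by positivity) y)
  set M := (max r⁻¹ 1) ^ m with hM
  have hM1 : 1 ≤ M := one_le_pow₀ (le_max_right _ _)
  have hdF : ∀ y t, 0 ≤ t → ‖fderiv ℝ F y‖ * t ≤ 2 * (L / r) * (M * φ ‖y‖ + φ t) := fun y t ht => by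
    refine (h.norm_fderiv_truncatedMean_mul_le hS hr ha hab hL1 hL y ht).trans ?_
    gcongr
    exact h.comp_mul_norm_le (by positivity) y
  have hfdη : Continuous (fderiv ℝ η) := hη'.continuous_fderiv one_ne_zero
  have hfdF : Continuous (fderiv ℝ F) := hF1.continuous_fderiv one_ne_zero
  have hzη : ∀ x, x ∉ Metric.closedBall x₀ ρ → η x = 0 ∧ fderiv ℝ η x = 0 := fun x hx =>
    ⟨image_eq_zero_of_notMem_tsupport fun h => hx (hηs h),
      image_eq_zero_of_notMem_tsupport (fun h => hx (hηs (tsupport_fderiv_subset ℝ h)))⟩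
  have hηc : HasCompactSupport η := HasCompactSupport.of_support_subset_isCompact
    (isCompact_closedBall x₀ ρ) ((subset_tsupport _).trans hηs)
  -- Sobolev's inequality holds for the smooth approximants; this is the limit of its right-hand
  -- side, and `key2` that of its left-hand side.
  have key1 := hw.tendsto_integral_of_support (ρ := ρ) (by linarith)
    (Ψ := fun x y Q => ‖fderiv ℝ η x‖ * F y + η x * (‖fderiv ℝ F y‖ * ‖Q‖))
    (C := 3 * (L / r) * M) (g := fun _ => 0) (by positivity) integrableOn_zero
    (fun k => by
      have h1 := (hw1 k).continuous
      have h2 := continuous_classicalGradient (hw1 k)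
      have h3 := hF1.continuous
      have h4 := hη'.continuous
      exact Continuous.aestronglyMeasurable (by fun_prop))
    (fun x _ => by
      have h3 := hF1.continuous
      fun_prop)
    (fun x _ y Q => by
      have e1 := hF0 y
      have e2 := hη0 x
      rw [abs_of_nonneg (by positivity), add_zero]
      have e3 := h.nonneg _ (norm_nonneg y)
      have e4 := h.nonneg _ (norm_nonneg Q)
      have e5 : ‖fderiv ℝ η x‖ * F y ≤ (L / r) * (M * φ ‖y‖) := by
        gcongr
        · exact hdη x
        · exact hFφ y
      have e6 : η x * (‖fderiv ℝ F y‖ * ‖Q‖) ≤ 1 * (2 * (L / r) * (M * φ ‖y‖ + M * φ ‖Q‖)) := by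
        refine mul_le_mul (hη1 x) ((hdF y ‖Q‖ (norm_nonneg _)).trans ?_) (by positivity) one_pos.le
        gcongr
        exact le_mul_of_one_le_left e4 hM1
      have e7 : 0 ≤ (L / r) * (M * φ ‖Q‖) := by positivity
      linarith)
    (fun x hx y Q => by simp [hzη x hx])
  have key2 := hw.tendsto_integral_of_support (ρ := ρ) (by linarith)
    (Ψ := fun x y _ => E.indicator (fun x => η x * F y) x)
    (C := M) (g := fun _ => 0) (by positivity) integrableOn_zero
    (fun k => by
      have h1 := (hw1 k).continuous
      have h3 := hF1.continuous
      have h4 := hη'.continuous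
      have h5 : Continuous fun x => η x * F (w k x) := by fun_prop
      exact (h5.aestronglyMeasurable.indicator hE).congr (Eventually.of_forall fun x => by
        by_cases hx : x ∈ E <;> simp [hx]))
    (fun x _ => by
      have h3 := hF1.continuous
      by_cases hx : x ∈ E
      · simp only [indicator_of_mem hx]; fun_prop
      · simp only [indicator_of_notMem hx]; fun_prop)
    (fun x _ y Q => by
      have e1 := hF0 y
      have e2 := hη0 x
      have e3 := h.nonneg _ (norm_nonneg y)
      have e4 := h.nonneg _ (norm_nonneg Q)
      rw [add_zero]
      by_cases hx : x ∈ E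
      · rw [indicator_of_mem hx, abs_of_nonneg (by positivity)]
        calc η x * F y ≤ 1 * F y := by gcongr; exact hη1 x
          _ ≤ M * φ ‖y‖ := by rw [one_mul]; exact hFφ y
          _ ≤ _ := by gcongr; linarith
      · rw [indicator_of_notMem hx, abs_zero]
        positivity)
    (fun x hx y Q => by
      by_cases hx' : x ∈ E <;> simp [hx', hzη x hx])
  refine ⟨key1.1, ?_⟩
  have hEeq : ∀ v : Vec n → Vec N, ∫ x, E.indicator (fun x' => η x' * F (v x)) x =
      ∫ x in E, η x * F (v x) := fun v => by
    rw [← integral_indicator hE]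
    refine integral_congr_ae (Eventually.of_forall fun x => ?_)
    by_cases hx : x ∈ E <;> simp [hx]
  have hk : ∀ k, ∫ x in E, η x * F (w k x) ≤ C * volume.real E ^ (1 / n : ℝ) *
      ∫ x, (‖fderiv ℝ η x‖ * F (w k x) +
        η x * (‖fderiv ℝ F (w k x)‖ * ‖classicalGradient (w k) x‖)) := by
    intro k
    have hW : ContDiff ℝ 1 fun x => η x * F (w k x) := hη'.mul (hF1.comp (hw1 k))
    have hWc : HasCompactSupport fun x => η x * F (w k x) := hηc.mul_right
    have h1 := hC _ hW hWc E hEf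
    simp_rw [abs_of_nonneg (mul_nonneg (hη0 _) (hF0 _))] at h1
    refine h1.trans ?_
    refine mul_le_mul_of_nonneg_left ?_ (by positivity)
    refine integral_mono
      ((hW.continuous_fderiv one_ne_zero).integrable_of_hasCompactSupport (hWc.fderiv ℝ)).norm
      (Continuous.integrable_of_hasCompactSupport ?_ ?_) fun x => ?_
    · have h1 := (hw1 k).continuous
      have h2 := continuous_classicalGradient (hw1 k)
      have h3 := hF1.continuous
      have h4 := hη'.continuous
      fun_prop
    · refine HasCompactSupport.of_support_subset_isCompact
        (isCompact_closedBall x₀ ρ) fun x hx => ?_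
      by_contra h'
      exact hx (by simp [hzη x h'])
    · exact norm_fderiv_mul_comp_le (hη'.differentiable one_ne_zero)
        (hF1.differentiable one_ne_zero) ((hw1 k).differentiable one_ne_zero) (hη0 x) (hF0 _)
  have key2' := key2.2
  simp_rw [hEeq] at key2'
  exact le_of_tendsto_of_tendsto' key2' (key1.2.const_mul _) hk

/-- One step of the De Giorgi iteration. -/
lemma IsLocalSolution.deGiorgi_step (hl : IsLocalSolution φ m Ω u G) (hu : Measurable u)
    {S L C : ℝ}
    (hS : ∀ t, |deriv Real.smoothTransition t| ≤ S) {x₀ : Vec n} {R ρ r a b : ℝ}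
    (hC0 : 0 ≤ C)
    (hC : ∀ W : Vec n → ℝ, ContDiff ℝ 1 W → HasCompactSupport W → ∀ E : Set (Vec n),
      volume E ≠ ⊤ →
      ∫ x in E, |W x| ≤ C * volume.real E ^ (1 / n : ℝ) * ∫ x, ‖fderiv ℝ W x‖)
    (hR : Metric.ball x₀ R ⊆ Ω) (hρ0 : 0 ≤ ρ) (hρ : ρ < R) (hr : 0 < r) (ha : 0 < a) (hab : a < b)
    (hL1 : 1 ≤ L) (hL : 4 * S / (b - a) ≤ L / b) (hL' : 8 * S / (R - ρ) ≤ L / r) :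
    ∫ x in superlevel u x₀ ρ b, φ (r⁻¹ * ‖u x‖) ≤
      2 ^ (m + 1) * C * (3 + 4 * caccioppoliConst m) * L ^ (m + 1) * r⁻¹ *
        (∫ x in superlevel u x₀ R a, φ (r⁻¹ * ‖u x‖)) *
        ((∫ x in superlevel u x₀ R a, φ (r⁻¹ * ‖u x‖)) / φ (r⁻¹ * a)) ^ (1 / n : ℝ) := by
  have h := hl.growth
  have hS0 : 0 ≤ S := (abs_nonneg _).trans (hS 0)
  -- The midpoints split the step. The Caccioppoli inequality works between the radii `s`, `R` and
  -- the levels `a`, `c`, Sobolev's inequality between the radii `ρ`, `s` and the levels `c`, `b`.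
  set s := (ρ + R) / 2 with hs
  set c := (a + b) / 2 with hc
  have hRρ : 0 < R - ρ := by linarith
  have hba : 0 < b - a := by linarith
  have hac : a < c := by linarith
  have hcb : c < b := by linarith
  obtain ⟨η, hη, hη0, hη1, hηone, hηs, hdη⟩ := exists_cutoff hS x₀ hρ0 (show ρ < s by linarith)
  have hdη' : ∀ x, ‖fderiv ℝ η x‖ ≤ L / r := fun x => by
    refine (hdη x).trans (le_trans ?_ hL')
    have : s - ρ = (R - ρ) / 2 := by rw [hs]; ring
    rw [this, div_le_div_iff₀ (by linarith) hRρ]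
    nlinarith
  set E := superlevel u x₀ ρ b with hEdef
  set D := Metric.closedBall x₀ s ∩ {x | c ≤ ‖u x‖} with hD
  set Q := superlevel u x₀ R a with hQ
  have hEm : MeasurableSet E := measurableSet_superlevel hu _ _ _
  have hQm : MeasurableSet Q := measurableSet_superlevel hu _ _ _
  have hDm : MeasurableSet D :=
    measurableSet_closedBall.inter (measurableSet_le measurable_const hu.norm)
  have hEf : volume E ≠ ⊤ :=
    ((measure_mono inter_subset_left).trans_lt measure_ball_lt_top).ne
  have hQf : volume Q ≠ ⊤ :=
    ((measure_mono inter_subset_left).trans_lt measure_ball_lt_top).ne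
  have hEQ : E ⊆ Q := fun x hx =>
    ⟨Metric.ball_subset_ball hρ.le hx.1, hab.trans hx.2⟩
  have hDQ : D ⊆ Q := fun x hx =>
    ⟨Metric.closedBall_subset_ball (by linarith) hx.1, hac.trans_le hx.2⟩
  have hQΩ : Q ⊆ Ω := fun x hx => hR hx.1
  have hiΩ : IntegrableOn (fun x => φ (r⁻¹ * ‖u x‖)) Ω := hl.integrableOn_comp_mul (by positivity)
  have hiQ := hiΩ.mono_set hQΩ
  have hφ0 : ∀ x, 0 ≤ φ (r⁻¹ * ‖u x‖) := fun x => h.nonneg _ (by positivity)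
  set A := ∫ x in Q, φ (r⁻¹ * ‖u x‖) with hA
  have hA0 : 0 ≤ A := integral_nonneg fun x => hφ0 x
  have hc0 : 0 < c := ha.trans hac
  have hφa : 0 < φ (r⁻¹ * a) := h.pos _ (by positivity)
  obtain ⟨hint, hsob⟩ := hl.setIntegral_truncatedMean_le (L := L) hS hC0 hC hR
    (show s < R by linarith) hr hc0 hcb hL1
    (by
      have : b - c = (b - a) / 2 := by rw [hc]; ring
      rw [this]
      refine le_trans (le_of_eq ?_) hL
      field_simp
      ring) hη hη0 hη1 hηs hdη' hEm hEf
  have hcacc := hl.caccioppoli hu hS hR (hρ0.trans (by linarith : ρ ≤ s))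
    (show s < R by linarith) hr hL1
    (by
      have : R - s = (R - ρ) / 2 := by rw [hs]; ring
      rw [this]
      refine le_trans (le_of_eq ?_) hL'
      field_simp
      ring) ha.le hac
  have hiD1 := hiΩ.mono_set (hDQ.trans hQΩ)
  have hiD2 := hl.integrable_grad.mono_set (hDQ.trans hQΩ)
  -- The integrand vanishes off `D`, either through `η` or through the truncation. On `D` the
  -- modular of `u` enters once from `∇η` and twice from `∇F`, and the modular of the gradient,
  -- entering twice, is estimated by Caccioppoli.
  have hmaj : ∫ x, (‖fderiv ℝ η x‖ * truncatedMean φ r c b (u x) +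
      η x * (‖fderiv ℝ (truncatedMean φ r c b) (u x)‖ * ‖G x‖)) ≤
      (L / r) * (3 * A + 2 * (2 * caccioppoliConst m * L ^ m * A)) := by
    have h1 : ∫ x, (‖fderiv ℝ η x‖ * truncatedMean φ r c b (u x) +
        η x * (‖fderiv ℝ (truncatedMean φ r c b) (u x)‖ * ‖G x‖)) ≤
        ∫ x, D.indicator (fun x => (L / r) * (3 * φ (r⁻¹ * ‖u x‖) + 2 * φ ‖G x‖)) x := by
      refine integral_mono hint (IntegrableOn.integrable_indicator
        (((hiD1.const_mul 3).add (hiD2.const_mul 2)).const_mul _) hDm) fun x => ?_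
      by_cases hx : x ∈ D
      · simp only [indicator_of_mem hx]
        have e1 := h.norm_fderiv_truncatedMean_mul_le (S := S) (L := L) hS hr hc0 hcb hL1
          (by
            have : b - c = (b - a) / 2 := by rw [hc]; ring
            rw [this]
            refine le_trans (le_of_eq ?_) hL
            field_simp
            ring) (u x) (norm_nonneg (G x))
        have e2 := h.truncatedMean_le hr hc0.le hcb (u x)
        have e3 := h.truncatedMean_nonneg hr hc0.le hcb (u x)
        have e4 : ‖fderiv ℝ η x‖ * truncatedMean φ r c b (u x) ≤ (L / r) * φ (r⁻¹ * ‖u x‖) := by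
          gcongr
          exact hdη' x
        have e5 := mul_le_of_le_one_left
          (a := η x) (b := ‖fderiv ℝ (truncatedMean φ r c b) (u x)‖ * ‖G x‖) (by positivity) (hη1 x)
        linarith
      · simp only [indicator_of_notMem hx]
        by_cases hxs : x ∈ Metric.closedBall x₀ s
        · have hux : ‖u x‖ ≤ c := by
            by_contra h'; exact hx ⟨hxs, (not_le.1 h').le⟩
          rw [truncatedMean_of_le hc0.le hcb hux, h.fderiv_truncatedMean_of_le hr hc0.le hcb hux]
          simp
        · rw [image_eq_zero_of_notMem_tsupport (f := η) (fun h => hxs (hηs h)),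
            image_eq_zero_of_notMem_tsupport (f := fderiv ℝ η)
              (fun h => hxs (hηs (tsupport_fderiv_subset ℝ h)))]
          simp
    refine h1.trans ?_
    rw [integral_indicator hDm, integral_const_mul,
      integral_add (hiD1.const_mul 3) (hiD2.const_mul 2), integral_const_mul, integral_const_mul]
    have h2 : ∫ x in D, φ (r⁻¹ * ‖u x‖) ≤ A :=
      setIntegral_mono_set hiQ (Eventually.of_forall hφ0) hDQ.eventuallyLE
    gcongr
  -- Chebyshev's inequality, since `‖u‖ > a` on `Q ⊇ E`.
  have hvol : volume.real E ≤ A / φ (r⁻¹ * a) := by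
    rw [le_div_iff₀ hφa]
    have h1 : ∫ _ in Q, φ (r⁻¹ * a) ≤ A := by
      refine setIntegral_mono_on (integrableOn_const hQf) hiQ hQm fun x hx => ?_
      exact h.mono (by positivity) (by gcongr; exact hx.2.le)
    rw [setIntegral_const, smul_eq_mul] at h1
    refine le_trans ?_ h1
    gcongr
  have hE1 : ∫ x in E, φ (r⁻¹ * ‖u x‖) ≤
      2 ^ (m + 1) * ∫ x in E, η x * truncatedMean φ r c b (u x) := by
    rw [← integral_const_mul]
    have hb : ∀ x ∈ E, φ (r⁻¹ * ‖u x‖) ≤ 2 ^ (m + 1) * (η x * truncatedMean φ r c b (u x)) :=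
      fun x hx => by
        rw [hηone x (Metric.ball_subset_closedBall hx.1), one_mul]
        exact h.le_truncatedMean hr hc0.le hcb hx.2.le
    have hmeas : Measurable fun x => η x * truncatedMean φ r c b (u x) :=
      hη.continuous.measurable.mul
        ((h.contDiff_truncatedMean hr hc0 hcb).continuous.measurable.comp hu)
    refine setIntegral_mono_on (hiQ.mono_set hEQ) (((hiQ.mono_set hEQ).mono'
      hmeas.aestronglyMeasurable (Eventually.of_forall fun x => ?_)).const_mul _) hEm hb
    have e3 := h.truncatedMean_nonneg hr hc0.le hcb (u x)
    rw [Real.norm_of_nonneg (mul_nonneg (hη0 x) e3)]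
    exact (mul_le_of_le_one_left e3 (hη1 x)).trans (h.truncatedMean_le hr hc0.le hcb (u x))
  have hcc : 0 ≤ caccioppoliConst m := by unfold caccioppoliConst; positivity
  have hLm : (1 : ℝ) ≤ L ^ m := one_le_pow₀ hL1
  calc _ ≤ _ := hE1
    _ ≤ 2 ^ (m + 1) * (C * (A / φ (r⁻¹ * a)) ^ (1 / n : ℝ) *
        ((L / r) * (3 * A + 2 * (2 * caccioppoliConst m * L ^ m * A)))) := by
      refine mul_le_mul_of_nonneg_left (hsob.trans ?_) (by positivity)
      refine mul_le_mul (by gcongr) hmaj (integral_nonneg fun x => ?_) (by positivity)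
      have := h.truncatedMean_nonneg hr hc0.le hcb (u x)
      have := hη0 x
      positivity
    _ ≤ 2 ^ (m + 1) * (C * (A / φ (r⁻¹ * a)) ^ (1 / n : ℝ) *
        ((L / r) * (3 * (L ^ m * A) + 2 * (2 * caccioppoliConst m * L ^ m * A)))) := by
      gcongr
      exact le_mul_of_one_le_left hA0 hLm
    _ = _ := by
      rw [div_eq_mul_inv L r, pow_succ L]
      ring

end OneStep

/-- Fast geometric convergence. -/
lemma le_mul_pow_of_recursion {y : ℕ → ℝ} {α K B θ ε : ℝ} (hα : 0 ≤ α) (hK : 0 ≤ K) (hB : 0 ≤ B)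
    (hθ : 0 ≤ θ) (hε : 0 ≤ ε) (hy : ∀ k, 0 ≤ y k)
    (hrec : ∀ k, y (k + 1) ≤ K * B ^ k * y k * y k ^ α) (h0 : y 0 ≤ ε) (hKε : K * ε ^ α ≤ θ)
    (hBθ : B * θ ^ α ≤ 1) (k : ℕ) : y k ≤ ε * θ ^ k := by
  induction k with
  | zero => simpa using h0
  | succ k ih =>
    have h1 : (θ ^ k) ^ α = (θ ^ α) ^ k := by
      rw [← Real.rpow_natCast, ← Real.rpow_natCast, ← Real.rpow_mul hθ, ← Real.rpow_mul hθ,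
        mul_comm]
    have h2 : 0 ≤ B * θ ^ α := by positivity
    -- The gain `(θ ^ α) ^ k` in the superlinear factor offsets the growth `B ^ k`, and the
    -- smallness of `ε` supplies one more factor `θ`.
    calc y (k + 1) ≤ K * B ^ k * y k * y k ^ α := hrec k
      _ ≤ K * B ^ k * (ε * θ ^ k) * (ε * θ ^ k) ^ α := by
        have := hy k
        gcongr
      _ = ε * θ ^ k * (K * ε ^ α) * (B * θ ^ α) ^ k := by
        rw [Real.mul_rpow hε (by positivity), h1, mul_pow]
        ring
      _ ≤ ε * θ ^ k * θ * 1 := by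
        gcongr
        exact pow_le_one₀ h2 hBθ
      _ = ε * θ ^ (k + 1) := by ring

/-! ### De Giorgi's criterion and the supremum bound -/

section Boundedness

variable {φ : ℝ → ℝ} {m : ℕ}

/-- De Giorgi's boundedness criterion. -/
lemma exists_smallness_const (n m : ℕ) (hn : 1 ≤ n) : ∃ ε : ℝ, 0 < ε ∧
    ∀ (N : ℕ) (φ : ℝ → ℝ) (Ω : Set (Vec n)) (u : Vec n → Vec N) (G : Vec n → Mat n N)
      (x₀ : Vec n) (r l : ℝ), IsLocalSolution φ m Ω u G → Measurable u → 0 < r → 0 < l →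
      Metric.ball x₀ (2 * r) ⊆ Ω →
      ∫ x in Metric.ball x₀ (2 * r), φ (r⁻¹ * ‖u x‖) ≤ ε * (φ (r⁻¹ * (l / 2)) * r ^ n) →
      ∀ᵐ x ∂volume.restrict (Metric.ball x₀ r), ‖u x‖ ≤ l := by
  obtain ⟨S, hS1, hS⟩ := exists_smoothTransition_deriv_bound
  obtain ⟨C, hC0, hC⟩ := exists_real_sobolev_const n hn
  set α : ℝ := 1 / n with hα
  have hα0 : 0 < α := by have : (0 : ℝ) < n := by exact_mod_cast hn
                         positivity
  set B : ℝ := 2 ^ (m + 1) with hB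
  have hB1 : 1 < B := one_lt_pow₀ one_lt_two (by omega)
  -- The decay rate solves `B θ ^ α = 1`, and the threshold `ε` below solves `K ε ^ α = θ`, as fast
  -- geometric convergence requires.
  set θ : ℝ := B ^ (-α⁻¹) with hθ
  have hθ0 : 0 < θ := by positivity
  have hθ1 : θ < 1 := Real.rpow_lt_one_of_one_lt_of_neg hB1 (by simpa using hα0)
  have hBθ : B * θ ^ α = 1 := by
    rw [hθ, ← Real.rpow_mul (by positivity), neg_mul, inv_mul_cancel₀ hα0.ne', Real.rpow_neg_one,
      mul_inv_cancel₀ (by positivity)]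
  have hcc : 0 ≤ caccioppoliConst m := by unfold caccioppoliConst; positivity
  set K : ℝ := 2 ^ (m + 1) * C * (3 + 4 * caccioppoliConst m) * (16 * S) ^ (m + 1) with hK
  have hK0 : 0 < K := by positivity
  refine ⟨(θ / K) ^ α⁻¹, by positivity, ?_⟩
  set ε := (θ / K) ^ α⁻¹ with hε
  have hKε : K * ε ^ α = θ := by
    rw [hε, ← Real.rpow_mul (by positivity), inv_mul_cancel₀ hα0.ne', Real.rpow_one]
    field_simp
  intro N φ Ω u G x₀ r l hl hu hr hl0 hΩ hsmall
  have h := hl.growth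
  set P := φ (r⁻¹ * (l / 2)) with hP
  have hP0 : 0 < P := h.pos _ (by positivity)
  -- The radii start at `2 r` and the levels, because of the exponent `k + 1`, at `l / 2`, so that
  -- every level is positive.
  set R : ℕ → ℝ := fun k => r * (1 + (1 / 2) ^ k) with hR
  set γ : ℕ → ℝ := fun k => l * (1 - (1 / 2) ^ (k + 1)) with hγ
  have hhalf : ∀ k : ℕ, (0 : ℝ) < (1 / 2) ^ k ∧ ((1 / 2 : ℝ) ^ k ≤ 1) := fun k =>
    ⟨by positivity, pow_le_one₀ (by norm_num) (by norm_num)⟩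
  have hR2 : ∀ k, R k ≤ 2 * r := fun k => by
    have := hhalf k; simp only [hR]; nlinarith
  have hRr : ∀ k, r ≤ R k := fun k => by
    have := hhalf k; simp only [hR]; nlinarith
  have hγl : ∀ k, γ k ≤ l := fun k => by
    have := hhalf (k + 1); simp only [hγ]; nlinarith
  have hγ2 : ∀ k, l / 2 ≤ γ k := fun k => by
    have := hhalf k; simp only [hγ, pow_succ]; nlinarith
  have hφ0 : ∀ x, 0 ≤ φ (r⁻¹ * ‖u x‖) := fun x => h.nonneg _ (by positivity)
  have hiΩ : IntegrableOn (fun x => φ (r⁻¹ * ‖u x‖)) Ω := hl.integrableOn_comp_mul (by positivity)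
  set a : ℕ → ℝ := fun k => ∫ x in superlevel u x₀ (R k) (γ k), φ (r⁻¹ * ‖u x‖) with ha
  have ha0 : ∀ k, 0 ≤ a k := fun k => integral_nonneg fun x => hφ0 x
  have hstep : ∀ k, a (k + 1) ≤ K * B ^ k * r⁻¹ * a k * (a k / P) ^ α := by
    intro k
    have hk := hhalf k
    have hsub : R k - R (k + 1) = r * (1 / 2) ^ (k + 1) := by simp only [hR, pow_succ]; ring
    have hsubγ : γ (k + 1) - γ k = l * (1 / 2) ^ (k + 2) := by simp only [hγ, pow_succ]; ring
    have hpow : (1 / 2 : ℝ) ^ k * 2 ^ k = 1 := by rw [← mul_pow]; norm_num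
    have hγk : 0 < γ k := by linarith [hγ2 k]
    -- The gaps are `r 2^(-k-1)` for the radii and `l 2^(-k-2)` for the levels; both constraints on
    -- `L` lead to `16 S 2^k`, and `L ^ (m + 1)` explains `B = 2 ^ (m + 1)`.
    have h1 := hl.deGiorgi_step hu (L := 16 * S * 2 ^ k) hS hC0.le hC
      (x₀ := x₀) (R := R k) (ρ := R (k + 1)) (r := r) (a := γ k) (b := γ (k + 1))
      ((Metric.ball_subset_ball (hR2 k)).trans hΩ) (hr.le.trans (hRr _))
      (by have : 0 < r * (1 / 2) ^ (k + 1) := by positivity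
          linarith) hr hγk
      (by have : 0 < l * (1 / 2) ^ (k + 2) := by positivity
          linarith)
      (by have : (1 : ℝ) ≤ 2 ^ k := one_le_pow₀ one_le_two
          nlinarith)
      (by
        have e0 := hγ2 (k + 1)
        have e1 : (16 * S * 2 ^ k) / l ≤ (16 * S * 2 ^ k) / γ (k + 1) := by
          gcongr
          · linarith
          · exact hγl _
        refine le_trans (le_of_eq ?_) e1
        rw [hsubγ, div_eq_div_iff (by positivity) hl0.ne', pow_succ, pow_succ]
        linear_combination (-4 * S * l) * hpow)
      (by
        refine le_of_eq ?_
        rw [hsub, div_eq_div_iff (by positivity) hr.ne', pow_succ]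
        linear_combination (-8 * S * r) * hpow)
    refine h1.trans ?_
    have e1 : φ (r⁻¹ * (l / 2)) ≤ φ (r⁻¹ * γ k) := h.mono (by positivity) (by gcongr; exact hγ2 k)
    have e2 : K * B ^ k = 2 ^ (m + 1) * C * (3 + 4 * caccioppoliConst m) *
        (16 * S * 2 ^ k) ^ (m + 1) := by
      rw [hK, hB, mul_pow (16 * S) (2 ^ k), ← pow_mul, ← pow_mul, mul_comm k (m + 1)]
      ring
    rw [e2]
    have e3 := ha0 k
    have e4 : 0 ≤ (∫ x in superlevel u x₀ (R k) (γ k), φ (r⁻¹ * ‖u x‖)) / φ (r⁻¹ * γ k) :=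
      div_nonneg e3 (h.nonneg _ (by positivity))
    gcongr
  -- Scale-invariant normalization: as `α = 1 / n`, the power `(r ^ n) ^ α = r` cancels the factor
  -- `r⁻¹` of the recursion.
  set y : ℕ → ℝ := fun k => a k / (P * r ^ n) with hy
  have hy0 : ∀ k, 0 ≤ y k := fun k => div_nonneg (ha0 k) (by positivity)
  have hay : ∀ k, a k = P * r ^ n * y k := fun k => by
    simp only [hy]; field_simp
  have hrec : ∀ k, y (k + 1) ≤ K * B ^ k * y k * y k ^ α := by
    intro k
    have h1 := hstep k
    have h2 : (a k / P) ^ α = r * y k ^ α := by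
      have e1 : a k / P = r ^ n * y k := by rw [hay k]; field_simp
      have e2 : ((r ^ n : ℝ)) ^ α = r := by
        rw [← Real.rpow_natCast, ← Real.rpow_mul hr.le, hα, mul_one_div_cancel (by positivity),
          Real.rpow_one]
      rw [e1, Real.mul_rpow (by positivity) (hy0 k), e2]
    rw [h2, hay k, hay (k + 1)] at h1
    have h3 : 0 < P * r ^ n := by positivity
    refine le_of_mul_le_mul_left (h1.trans (le_of_eq ?_)) h3
    field_simp
  have hstart : y 0 ≤ ε := by
    simp only [hy]
    rw [div_le_iff₀ (by positivity)]
    refine le_trans ?_ hsmall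
    refine setIntegral_mono_set (hiΩ.mono_set hΩ) (Eventually.of_forall hφ0)
      (Eventually.of_forall fun x hx => Metric.ball_subset_ball (hR2 0) hx.1)
  have hdecay := le_mul_pow_of_recursion hα0.le hK0.le (by positivity) hθ0.le (by positivity) hy0
    hrec hstart hKε.le hBθ.le
  have hlim : Tendsto (fun k => P * r ^ n * (ε * θ ^ k)) atTop (𝓝 0) := by
    have := ((tendsto_pow_atTop_nhds_zero_of_lt_one hθ0.le hθ1).const_mul ε).const_mul (P * r ^ n)
    simpa using this
  set Q := superlevel u x₀ r l with hQ
  have hQm : MeasurableSet Q := measurableSet_superlevel hu _ _ _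
  have hQR : ∀ k, Q ⊆ superlevel u x₀ (R k) (γ k) := fun k x hx =>
    ⟨Metric.ball_subset_ball (hRr k) hx.1, (hγl k).trans_lt hx.2⟩
  have hsupΩ : ∀ k, superlevel u x₀ (R k) (γ k) ⊆ Ω := fun k x hx =>
    hΩ (Metric.ball_subset_ball (hR2 k) hx.1)
  have hQf : volume Q ≠ ⊤ := ((measure_mono inter_subset_left).trans_lt measure_ball_lt_top).ne
  -- The set where `‖u‖ > l` in the small ball lies in all superlevel sets of the iteration, whose
  -- integrals tend to zero.
  have hQint : ∫ x in Q, φ (r⁻¹ * ‖u x‖) ≤ 0 := by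
    refine ge_of_tendsto' hlim fun k => ?_
    have h1 : ∫ x in Q, φ (r⁻¹ * ‖u x‖) ≤ a k :=
      setIntegral_mono_set (hiΩ.mono_set (hsupΩ k)) (Eventually.of_forall hφ0)
        (Eventually.of_forall (hQR k))
    refine h1.trans ?_
    rw [hay k]
    exact mul_le_mul_of_nonneg_left (hdecay k) (by positivity)
  have hQ0 : volume Q = 0 := by
    have h1 : ∫ _ in Q, φ (r⁻¹ * l) ≤ ∫ x in Q, φ (r⁻¹ * ‖u x‖) := by
      refine setIntegral_mono_on (integrableOn_const hQf)
        (hiΩ.mono_set ((hQR 0).trans (hsupΩ 0))) hQm fun x hx => ?_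
      exact h.mono (by positivity) (by gcongr; exact hx.2.le)
    rw [setIntegral_const, smul_eq_mul] at h1
    have h2 : 0 < φ (r⁻¹ * l) := h.pos _ (by positivity)
    have h3 : volume.real Q ≤ 0 := by
      by_contra h'
      have := mul_pos (not_le.1 h') h2
      linarith
    exact (measureReal_eq_zero_iff hQf).1 (le_antisymm h3 measureReal_nonneg)
  rw [ae_restrict_iff' measurableSet_ball]
  filter_upwards [measure_eq_zero_iff_ae_notMem.1 hQ0] with x hx hxB
  by_contra h'
  exact hx ⟨hxB, not_le.1 h'⟩

lemma IsNFunction.exists_eq (h : IsNFunction φ) {c : ℝ} (hc : 0 ≤ c) : ∃ t, 0 ≤ t ∧ φ t = c := by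
  obtain ⟨T, hT1, hT⟩ := ((eventually_ge_atTop (1 : ℝ)).and
    (h.tendsto_atTop.eventually_ge_atTop c)).exists
  have h0 : 0 < T := by linarith
  rw [le_div_iff₀ h0] at hT
  have hTc : c ≤ φ T := by nlinarith
  obtain ⟨t, ht, rfl⟩ := intermediate_value_Icc h0.le
    (h.continuousOn.mono fun x hx => hx.1) (show c ∈ Icc (φ 0) (φ T) from
      ⟨by rwa [h.map_zero], hTc⟩)
  exact ⟨t, ht.1, rfl⟩

/-- Allows passing to a measurable representative, for which superlevel sets are measurable. -/
lemma IsLocalSolution.congr {n N : ℕ} {Ω : Set (Vec n)} {u v : Vec n → Vec N}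
    {G : Vec n → Mat n N} (hl : IsLocalSolution φ m Ω u G)
    (huv : u =ᵐ[volume.restrict Ω] v) : IsLocalSolution φ m Ω v G where
  growth := hl.growth
  weakGradient := by
    refine ⟨fun x hx => ?_, hl.weakGradient.2.1, fun η hη i j => ?_⟩
    · obtain ⟨s, hs, hus⟩ := hl.weakGradient.1 x hx
      refine ⟨s ∩ Ω, inter_mem hs self_mem_nhdsWithin, ?_⟩
      exact (hus.mono_set inter_subset_left).congr_fun_ae
        (ae_mono (Measure.restrict_mono inter_subset_right le_rfl) huv)
    · rw [← hl.weakGradient.2.2 η hη i j]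
      refine integral_congr_ae ?_
      filter_upwards [huv] with x hx
      rw [hx]
  integrable_fun := hl.integrable_fun.congr_fun_ae (by
    filter_upwards [huv] with x hx
    rw [hx])
  integrable_grad := hl.integrable_grad
  weak_eq := hl.weak_eq

lemma exists_sup_bound_const (n m : ℕ) (hn : 1 ≤ n) : ∃ c : ℝ, 0 < c ∧
    ∀ (N : ℕ) (φ : ℝ → ℝ) (Ω : Set (Vec n)) (u : Vec n → Vec N) (G : Vec n → Mat n N)
      (x₀ : Vec n) (r : ℝ), IsLocalSolution φ m Ω u G → 0 < r → Metric.ball x₀ (2 * r) ⊆ Ω →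
      ∃ M : ℝ, (∀ᵐ x ∂volume.restrict (Metric.ball x₀ r), ‖u x‖ ≤ M) ∧
        φ (r⁻¹ * M) ≤ c * ⨍ x in Metric.ball x₀ (2 * r), φ (r⁻¹ * ‖u x‖) := by
  obtain ⟨ε, hε, H⟩ := exists_smallness_const n m hn
  set κ := volume.real (Metric.ball (0 : Vec n) 1) with hκ
  have hκ0 : 0 < κ :=
    ENNReal.toReal_pos (Metric.measure_ball_pos _ _ one_pos).ne' measure_ball_lt_top.ne
  refine ⟨2 ^ m * (κ * 2 ^ n) / ε, by positivity, ?_⟩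
  intro N φ Ω u G x₀ r hl hr hΩ
  have h := hl.growth
  have hum : AEStronglyMeasurable u (volume.restrict Ω) := hl.weakGradient.1.aestronglyMeasurable
  have huv : u =ᵐ[volume.restrict Ω] hum.mk u := hum.ae_eq_mk
  have hball : Metric.ball x₀ r ⊆ Metric.ball x₀ (2 * r) := Metric.ball_subset_ball (by linarith)
  set A := ∫ x in Metric.ball x₀ (2 * r), φ (r⁻¹ * ‖u x‖) with hA
  have hA0 : 0 ≤ A := integral_nonneg fun x => h.nonneg _ (by positivity)
  have hAv : ∫ x in Metric.ball x₀ (2 * r), φ (r⁻¹ * ‖hum.mk u x‖) = A := by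
    refine integral_congr_ae ?_
    filter_upwards [ae_mono (Measure.restrict_mono hΩ le_rfl) huv] with x hx
    rw [hx]
  have key : ∀ t, 0 < t → A ≤ ε * (φ t * r ^ n) →
      ∀ᵐ x ∂volume.restrict (Metric.ball x₀ r), ‖u x‖ ≤ 2 * r * t := by
    intro t ht hAt
    have e1 : r⁻¹ * (2 * r * t / 2) = t := by field_simp
    have h1 := H N φ Ω (hum.mk u) G x₀ r (2 * r * t) (hl.congr huv)
      hum.stronglyMeasurable_mk.measurable hr (by positivity) hΩ (by rwa [hAv, e1])
    filter_upwards [h1, ae_mono (Measure.restrict_mono (hball.trans hΩ) le_rfl) huv] with x h2 h3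
    rwa [h3]
  -- The level `l = 2 r t` makes the smallness condition an equality. The bound then follows from
  -- `φ(2t) ≤ 2 ^ m φ(t)` and the volume `κ (2 r) ^ n` of the large ball.
  obtain ⟨t, ht0, ht⟩ := h.exists_eq (c := A / (ε * r ^ n)) (by positivity)
  have hAt : A = ε * (φ t * r ^ n) := by rw [ht]; field_simp
  refine ⟨2 * r * t, ?_, ?_⟩
  · rcases eq_or_lt_of_le ht0 with rfl | htpos
    -- If `t = 0`, then `A = 0` and the criterion, which needs a positive level, holds at every
    -- positive one; letting the levels tend to zero gives `u = 0` a.e.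
    · have hlim : Tendsto (fun k : ℕ => 2 * r * (1 / ((k : ℝ) + 1))) atTop (𝓝 (2 * r * 0)) :=
        (tendsto_one_div_add_atTop_nhds_zero_nat (𝕜 := ℝ)).const_mul _
      have hall : ∀ k : ℕ, ∀ᵐ x ∂volume.restrict (Metric.ball x₀ r),
          ‖u x‖ ≤ 2 * r * (1 / ((k : ℝ) + 1)) := fun k => by
        refine key _ (by positivity) ?_
        rw [hAt]
        gcongr
        exact h.mono le_rfl (by positivity)
      filter_upwards [ae_all_iff.2 hall] with x hx
      exact ge_of_tendsto' hlim hx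
    · exact key t htpos hAt.le
  · have hvol : volume.real (Metric.ball x₀ (2 * r)) = (2 * r) ^ n * κ := by
      rw [measureReal_def, Measure.addHaar_ball_of_pos _ _ (by positivity), ENNReal.toReal_mul,
        ENNReal.toReal_ofReal (by positivity), finrank_euclideanSpace_fin, hκ, measureReal_def]
    have e1 : r⁻¹ * (2 * r * t) = 2 * t := by field_simp
    rw [setAverage_eq, hvol, smul_eq_mul, ← hA, e1]
    refine (h.map_mul_le_pow one_le_two ht0).trans (le_of_eq ?_)
    rw [ht, mul_pow]
    field_simp

end Boundedness

end OrliczSystem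

end

/-! ### The main theorem -/

theorem theorem1p1 (n : ℕ) (q : ℝ) :
    ∃ c : ℝ, 0 < c ∧
      ∀ (N : ℕ) (p : ℝ) (φ : ℝ → ℝ) (Ω : Set (OrliczSystem.Vec n))
        (x₀ : OrliczSystem.Vec n) (r : ℝ) (u : OrliczSystem.Vec n → OrliczSystem.Vec N),
        1 ≤ p → p ≤ q →
        OrliczSystem.IsNFunction φ →
        OrliczSystem.HasSimonenkoIndices φ p q →
        IsOpen Ω → Bornology.IsBounded Ω →
        0 < r → Metric.ball x₀ (2 * r) ⊆ Ω →
        OrliczSystem.IsWeakSolution φ Ω u →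
        MemLp u ⊤ (volume.restrict (Metric.ball x₀ r)) ∧
        IntegrableOn (fun x => φ (r⁻¹ * ‖u x‖)) (Metric.ball x₀ (2 * r)) ∧
        essSup (fun x => ENNReal.ofReal (φ (r⁻¹ * ‖u x‖)))
            (volume.restrict (Metric.ball x₀ r)) ≤
          ENNReal.ofReal (c * ⨍ x in Metric.ball x₀ (2 * r), φ (r⁻¹ * ‖u x‖)) := by

  -- In dimension zero the space is a point, so `u` is constant and the supremum equals the average;
  -- Sobolev's inequality is available only for `n ≥ 1`.
  rcases Nat.eq_zero_or_pos n with rfl | hn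
  · refine ⟨1, one_pos, ?_⟩
    intro N p φ Ω x₀ r u _ _ _ _ _ _ hr _ _
    have hfin : ∀ s : ℝ, volume (Metric.ball x₀ s) ≠ ⊤ := fun s => measure_ball_lt_top.ne
    obtain ⟨v, rfl⟩ : ∃ v, u = fun _ => v :=
      ⟨u x₀, funext fun x => by rw [Subsingleton.elim x x₀]⟩
    refine ⟨memLp_top_const v, integrableOn_const (hfin _), ?_⟩
    rw [setAverage_const (Metric.measure_ball_pos _ _ (by positivity)).ne' (hfin _), one_mul]
    exact essSup_le_of_ae_le _ (Eventually.of_forall fun _ => le_rfl)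
  -- An integer exponent above `q` that depends on `q` only, so that the constant is independent of
  -- `φ`, `N` and the domain.
  · set m := max 2 ⌈q⌉₊ with hm
    obtain ⟨c, hc, H⟩ := OrliczSystem.exists_sup_bound_const n m hn
    refine ⟨c, hc, ?_⟩
    intro N p φ Ω x₀ r u hp _ hφ hi _ _ hr hball hu
    have h : OrliczSystem.IsPowerNFunction φ m := hφ.isPowerNFunction hi hp (le_max_left _ _)
      ((Nat.le_ceil q).trans (by exact_mod_cast le_max_right _ _))
    obtain ⟨G, hl⟩ := hu.exists_isLocalSolution h
    obtain ⟨M, hM, hφM⟩ := H N φ Ω u G x₀ r hl hr hball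
    have hsub : Metric.ball x₀ r ⊆ Ω := (Metric.ball_subset_ball (by linarith)).trans hball
    refine ⟨memLp_top_of_bound (hl.weakGradient.1.aestronglyMeasurable.mono_measure
      (Measure.restrict_mono hsub le_rfl)) M hM,
      (hl.integrableOn_comp_mul (by positivity)).mono_set hball, essSup_le_of_ae_le _ ?_⟩
    filter_upwards [hM] with x hx
    exact ENNReal.ofReal_le_ofReal ((h.mono (by positivity) (by gcongr)).trans hφM)
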